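/- Let $l,m,r$ be natural numbers, let $\mathcal M_{l,m}$ be the space of real $l\times m$ matrices with the scalar product $\langle A,B\rangle=\mathrm{Tr}(A^TB)$ and its (Frobenius) norm $\|\cdot\|$, and let $\mathscr M=\{R\in\mathcal M_{l,m}:\mathrm{rank}(R)=r\}$. For $R\in\mathscr M$ let $\mathcal T(R)$ be the tangent space of $\mathscr M$ at $R$, i.e. the set of velocities at $R$ of smooth curves drawn on $\mathscr M$, and let $\Pi_{\mathcal T(R)}$ be the orthogonal projection onto $\mathcal T(R)$. If $A\in\mathcal M_{l,m}$ has rank $d\ge r$, singular value decomposition $A=\sum_{i=1}^{d}\sigma_iu_iv_i^T$ with $\sigma_1\ge\dots\ge\sigma_d>0$, and $\sigma_r>\sigma_{r+1}$ (where $\sigma_{d+1}=0$; no condition if $r=0$), let $\Pi_{\mathscr M}(A)=\sum_{i=1}^{r}\sigma_iu_iv_i^T$ be its rank $r$ truncated SVD; for all other $A$, $\Pi_{\mathscr M}(A)$ is undefined. Let $T>0$ and let $\mathcal L(t,A)\in\mathcal M_{l,m}$, for $t\in[0,T]$ and $A\in\mathcal M_{l,m}$, be continuous in $t$ for every fixed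 $A$ and Lipschitz continuous in $A$: there is a constant $K$ with $$\|\mathcal L(t,A)-\mathcal L(t,B)\|\le K\|A-B\|\qquad\text{for all }t\in[0,T],\ A,B\in\mathcal M_{l,m}.$$ Let $A_0\in\mathcal M_{l,m}$ be such that $\Pi_{\mathscr M}(A_0)$ is defined, and assume that the dynamically orthogonal (DO) system $$\dot R(t)=\Pi_{\mathcal T(R(t))}\big(\mathcal L(t,R(t))\big),\qquad R(0)=\Pi_{\mathscr M}(A_0)$$ has a solution $R:[0,T]\to\mathscr M$. Let $\overline{\mathcal L}(t,A,h)\in\mathcal M_{l,m}$ be one of the following: (i) the increment of the exact integration, $\overline{\mathcal L}(t,A,h)=\frac1h\int_t^{t+h}\mathcal L(s,y(s))\,ds$ for $0\le t<t+h\le T$, where $y$ is the solution of $\dot y=\mathcal L(s,y)$ on $[t,t+h]$ with $y(t)=A$; (ii) the increment function of a consistent one-step time marching scheme for $\dot y=\mathcal L(t,y)$, that is, for some $h_0>0$, $\overline{\mathcal L}$ is continuous on the set of all $(t,A,h)$ with $t\ge0$, $0\le h\le h_0$, $t+h\le T$, and $\overline{\mathcal L}(t,A,0)=\mathcal L(t,A)$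 for all $t\in[0,T]$ and all $A$ (for example $\overline{\mathcal L}(t,A,h)=\mathcal L(t,A)$, forward Euler, or $\overline{\mathcal L}(t,A,h)=\mathcal L(t+h/2,A+\tfrac h2\mathcal L(t,A))$, a second-order Runge–Kutta scheme). For a positive integer $N_T$ put $\Delta t=T/N_T$ and $t^n=n\Delta t$, and consider the scheme that truncates the SVD after each time step, $$R^0=\Pi_{\mathscr M}(A_0),\qquad R^{n+1}=\Pi_{\mathscr M}\big(R^n+\Delta t\,\overline{\mathcal L}(t^n,R^n,\Delta t)\big)\quad(0\le n<N_T).$$ Then for all sufficiently large $N_T$ the sequence $R^0,\dots,R^{N_T}$ is well defined (every truncated SVD that occurs is defined and single-valued), and it converges uniformly to the DO solution: $$\sup_{0\le n\le N_T}\|R^n-R(t^n)\|\longrightarrow 0\qquad\text{as }\Delta t=T/N_T\to0.$$ -/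

import Mathlib

open Filter Topology Set MeasureTheory
open scoped Matrix ContDiff Matrix.Norms.Frobenius

/-- `A = ∑ i, σ i • uᵢ vᵢᵀ` is a (reduced) singular value decomposition of `A`: the singular values
`σ i` are positive and listed in decreasing order, and the left and right singular vectors `uᵢ`,
`vᵢ`, which are the columns of `U` and `V`, are orthonormal. The number `d` of terms is then the
rank of `A`. -/
structure IsSVD {l m d : ℕ} (A : Matrix (Fin l) (Fin m) ℝ) (σ : Fin d → ℝ)
    (U : Matrix (Fin l) (Fin d) ℝ) (V : Matrix (Fin m) (Fin d) ℝ) : Prop where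
  pos : ∀ i, 0 < σ i
  anti : Antitone σ
  left_orthonormal : Uᵀ * U = 1
  right_orthonormal : Vᵀ * V = 1
  eq_sum : A = ∑ i, σ i • Matrix.vecMulVec (U.col i) (V.col i)

/-- `B = Π_M(A)`: the matrix `A` has rank at least `r`, its singular values satisfy
`σ_r > σ_{r+1}` (with `σ_{r+1} = 0` if `A` has rank `r`), and `B` is obtained from a singular value
decomposition of `A` by keeping its first `r` terms. -/
def IsTruncatedSVD {l m : ℕ} (r : ℕ) (A B : Matrix (Fin l) (Fin m) ℝ) : Prop :=
  ∃ (d : ℕ) (σ : Fin d → ℝ) (U : Matrix (Fin l) (Fin d) ℝ) (V : Matrix (Fin m) (Fin d) ℝ),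
    IsSVD A σ U V ∧ r ≤ d ∧ (∀ i j : Fin d, (i : ℕ) < r → r ≤ (j : ℕ) → σ j < σ i) ∧
    B = ∑ i ∈ Finset.univ.filter (fun i : Fin d => (i : ℕ) < r), σ i • Matrix.vecMulVec (U.col i) (V.col i)

/-- The manifold of `l × m` real matrices of rank `r`. -/
def fixedRank (l m r : ℕ) : Set (Matrix (Fin l) (Fin m) ℝ) := {A | A.rank = r}

/-- The tangent space at `R` of the manifold of matrices of rank `r`: the velocities at `R` of the
smooth curves drawn on the manifold. -/
def tangentSpaceAt {l m : ℕ} (r : ℕ) (R : Matrix (Fin l) (Fin m) ℝ) :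
    Set (Matrix (Fin l) (Fin m) ℝ) :=
  {X | ∃ (ε : ℝ) (γ : ℝ → Matrix (Fin l) (Fin m) ℝ), 0 < ε ∧ ContDiffOn ℝ ∞ γ (Ioo (-ε) ε) ∧
    (∀ t ∈ Ioo (-ε) ε, γ t ∈ fixedRank l m r) ∧ γ 0 = R ∧ HasDerivAt γ X 0}

/-- `P` is the orthogonal projection of `X` onto the tangent space at `R`, for the scalar product
`⟨A, B⟩ = Tr(Aᵀ B)`. -/
def IsTangentProjection {l m : ℕ} (r : ℕ) (R X P : Matrix (Fin l) (Fin m) ℝ) : Prop :=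
  P ∈ tangentSpaceAt r R ∧ ∀ Y ∈ tangentSpaceAt r R, ((X - P)ᵀ * Y).trace = 0

/-- `R` is, on `[0, T]`, a solution of the dynamically orthogonal system
`R' = Π_{T_R}(L(t, R))`, `R(0) = Π_M(A₀)` on the manifold of matrices of rank `r`
(with one-sided derivatives at the end points). -/
structure IsDOSolution {l m : ℕ} (r : ℕ) (T : ℝ)
    (L : ℝ → Matrix (Fin l) (Fin m) ℝ → Matrix (Fin l) (Fin m) ℝ)
    (A₀ : Matrix (Fin l) (Fin m) ℝ) (R : ℝ → Matrix (Fin l) (Fin m) ℝ) : Prop where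
  mem : ∀ t ∈ Icc 0 T, R t ∈ fixedRank l m r
  initial : IsTruncatedSVD r A₀ (R 0)
  deriv : ∀ t ∈ Icc 0 T, ∃ P, IsTangentProjection r (R t) (L t (R t)) P ∧
    HasDerivWithinAt R P (Icc 0 T) t

/-- `Lbar t A h` is the increment of the exact integration: the mean of `s ↦ L(s, y(s))` over
`[t, t + h]`, where `y` solves `y' = L(s, y)` on `[t, t + h]` with `y(t) = A`. -/
def IsExactIncrement {l m : ℕ} (T : ℝ)
    (L : ℝ → Matrix (Fin l) (Fin m) ℝ → Matrix (Fin l) (Fin m) ℝ)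
    (Lbar : ℝ → Matrix (Fin l) (Fin m) ℝ → ℝ → Matrix (Fin l) (Fin m) ℝ) : Prop :=
  ∀ (t h : ℝ) (A : Matrix (Fin l) (Fin m) ℝ), 0 ≤ t → 0 < h → t + h ≤ T →
    ∃ y : ℝ → Matrix (Fin l) (Fin m) ℝ, y t = A ∧
      (∀ s ∈ Icc t (t + h), HasDerivWithinAt y (L s (y s)) (Icc t (t + h)) s) ∧
      Lbar t A h = h⁻¹ • ∫ s in t..(t + h), L s (y s)

/-- `Lbar` is the increment function of a consistent one-step time marching scheme for
`y' = L(t, y)` on `[0, T]`: it is continuous (on the arguments met by the scheme for small time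
steps) and satisfies `Lbar(t, A, 0) = L(t, A)`. -/
structure IsConsistentIncrement {l m : ℕ} (T : ℝ)
    (L : ℝ → Matrix (Fin l) (Fin m) ℝ → Matrix (Fin l) (Fin m) ℝ)
    (Lbar : ℝ → Matrix (Fin l) (Fin m) ℝ → ℝ → Matrix (Fin l) (Fin m) ℝ) : Prop where
  continuousOn : ∃ h₀ > 0, ContinuousOn
    (fun p : ℝ × Matrix (Fin l) (Fin m) ℝ × ℝ => Lbar p.1 p.2.1 p.2.2)
    {p | 0 ≤ p.1 ∧ 0 ≤ p.2.2 ∧ p.2.2 ≤ h₀ ∧ p.1 + p.2.2 ≤ T}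
  consistent : ∀ t ∈ Icc 0 T, ∀ A, Lbar t A 0 = L t A

/-- `S 0, …, S N` is the sequence produced with the time step `T / N` by the scheme
`S (n+1) = Π_M(S n + Δt Lbar(tⁿ, S n, Δt))`, `S 0 = Π_M(A₀)`, where `tⁿ = n Δt`. -/
structure IsTruncationScheme {l m : ℕ} (r : ℕ) (T : ℝ)
    (Lbar : ℝ → Matrix (Fin l) (Fin m) ℝ → ℝ → Matrix (Fin l) (Fin m) ℝ)
    (A₀ : Matrix (Fin l) (Fin m) ℝ) (N : ℕ)
    (S : Fin (N + 1) → Matrix (Fin l) (Fin m) ℝ) : Prop where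
  initial : IsTruncatedSVD r A₀ (S 0)
  step : ∀ n : Fin N, IsTruncatedSVD r
    (S n.castSucc + (T / N) • Lbar (n * (T / N)) (S n.castSucc) (T / N)) (S n.succ)

/-! ### The Frobenius norm and orthogonal projections -/

/-! To second order, truncating the SVD is projecting onto the tangent space. If `R` has rank `r`
and Moore–Penrose inverse `M`, then the truncation of `A` is `R + tangentProj R M (A - R)` up to `8
* ‖M‖ * ‖A - R‖ ^ 2` (`norm_sub_sub_tangentProj_le`). The increment function tends to `L` uniformly
on bounded sets as the step `h` tends to 0, so each step of the scheme is an Euler step for the DO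
system up to o(h).

The geometry is carried by the orthogonal projections `R * M` and `M * R` onto the column and row
spaces. The tangent space at `R` consists of the `X` with `(1 - R * M) * X * (1 - M * R) = 0`, so
`tangentProj` is the orthogonal projection onto it. It depends on `R` in a Lipschitz way with
constant governed by `‖M‖`, because two such projections of equal rank differ by at most `2 * ‖M‖ *
‖R - S‖`. Compactness bounds `‖M‖` along the DO solution, and `IsPinv.norm_le_two_mul` extends the
bound to a tube around it. There truncation after a short step is possible
(`exists_isTruncatedSVD`), and it is single-valued by the equality case of Eckart–Young
(`IsSVD.mul_eq_truncation`).

Altogether one step turns an error e into at most (1 + Ch)e + εh (`exists_step_bound`). A discrete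
Gronwall argument then keeps the iterates in the tube and gives convergence
(`eventually_scheme_bound`). No rate results, since `L` is merely continuous in time. -/

lemma frobenius_norm_sq {l m : ℕ} (A : Matrix (Fin l) (Fin m) ℝ) :
    ‖A‖ ^ 2 = (Aᵀ * A).trace := by
  rw [Matrix.frobenius_norm_def, ← Real.sqrt_eq_rpow, Real.sq_sqrt (by positivity)]
  simp only [Matrix.trace, Matrix.diag, Matrix.mul_apply, Matrix.transpose_apply, Real.norm_eq_abs]
  rw [Finset.sum_comm]
  refine Finset.sum_congr rfl fun i _ => Finset.sum_congr rfl fun j _ => ?_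
  rw [Real.rpow_two, sq_abs, sq]

lemma eq_zero_of_trace_transpose_mul_self {l m : ℕ} {A : Matrix (Fin l) (Fin m) ℝ}
    (h : (Aᵀ * A).trace = 0) : A = 0 := by
  rw [← frobenius_norm_sq] at h
  exact norm_eq_zero.mp (pow_eq_zero_iff two_ne_zero |>.mp h)

/-- `p` is the matrix of an orthogonal projection. -/
structure IsOrthProj {l : ℕ} (p : Matrix (Fin l) (Fin l) ℝ) : Prop where
  symm : pᵀ = p
  idem : p * p = p

namespace IsOrthProj

variable {l m : ℕ} {p q : Matrix (Fin l) (Fin l) ℝ}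

lemma compl (hp : IsOrthProj p) : IsOrthProj (1 - p) where
  symm := by simp [hp.symm]
  idem := by simp [mul_sub, sub_mul, hp.idem]

lemma norm_sq_mul (hp : IsOrthProj p) (X : Matrix (Fin l) (Fin m) ℝ) :
    ‖p * X‖ ^ 2 = (Xᵀ * p * X).trace := by
  rw [frobenius_norm_sq, Matrix.transpose_mul, hp.symm]
  congr 1
  rw [Matrix.mul_assoc, ← Matrix.mul_assoc p p, hp.idem, Matrix.mul_assoc]

lemma norm_sq_add (hp : IsOrthProj p) (X : Matrix (Fin l) (Fin m) ℝ) :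
    ‖p * X‖ ^ 2 + ‖(1 - p) * X‖ ^ 2 = ‖X‖ ^ 2 := by
  rw [hp.norm_sq_mul, hp.compl.norm_sq_mul, frobenius_norm_sq, Matrix.mul_sub, Matrix.sub_mul,
    Matrix.trace_sub, Matrix.mul_one]
  ring

lemma norm_mul_le (hp : IsOrthProj p) (X : Matrix (Fin l) (Fin m) ℝ) : ‖p * X‖ ≤ ‖X‖ := by
  have := hp.norm_sq_add X
  exact le_of_sq_le_sq (by nlinarith [sq_nonneg ‖(1 - p) * X‖]) (norm_nonneg _)

lemma norm_mul_le' (hp : IsOrthProj p) (X : Matrix (Fin m) (Fin l) ℝ) : ‖X * p‖ ≤ ‖X‖ := by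
  have := hp.norm_mul_le Xᵀ
  rwa [← Matrix.frobenius_norm_transpose, Matrix.transpose_mul, Matrix.transpose_transpose,
    hp.symm, Matrix.frobenius_norm_transpose] at this

lemma norm_sq_mul_compl (hp : IsOrthProj p) (hq : IsOrthProj q) :
    ‖p * (1 - q)‖ ^ 2 = p.trace - (p * q).trace := by
  rw [hp.norm_sq_mul, hq.compl.symm, Matrix.trace_mul_comm, ← Matrix.mul_assoc, hq.compl.idem,
    Matrix.trace_mul_comm, Matrix.mul_sub, Matrix.mul_one, Matrix.trace_sub]

/-- Both squares equal the common rank minus `(p * q).trace`. This symmetry is what lets later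
bounds involve the Moore–Penrose inverse of only one of two matrices. -/
lemma norm_mul_compl_comm (hp : IsOrthProj p) (hq : IsOrthProj q) (h : p.trace = q.trace) :
    ‖p * (1 - q)‖ = ‖q * (1 - p)‖ := by
  refine (sq_eq_sq₀ (norm_nonneg _) (norm_nonneg _)).mp ?_
  rw [hp.norm_sq_mul_compl hq, hq.norm_sq_mul_compl hp, h, Matrix.trace_mul_comm]

lemma norm_compl_mul (hp : IsOrthProj p) (hq : IsOrthProj q) :
    ‖(1 - p) * q‖ = ‖q * (1 - p)‖ := by
  rw [← Matrix.frobenius_norm_transpose, Matrix.transpose_mul, hq.symm, hp.compl.symm]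

lemma norm_sub_sq (hp : IsOrthProj p) (hq : IsOrthProj q) (h : p.trace = q.trace) :
    ‖p - q‖ ^ 2 = 2 * ‖p * (1 - q)‖ ^ 2 := by
  rw [hp.norm_sq_mul_compl hq, frobenius_norm_sq, Matrix.transpose_sub, hp.symm, hq.symm,
    mul_sub, sub_mul, sub_mul, hp.idem, hq.idem, Matrix.trace_sub, Matrix.trace_sub,
    Matrix.trace_sub, Matrix.trace_mul_comm q p, h]
  ring

lemma norm_sub_le (hp : IsOrthProj p) (hq : IsOrthProj q) (h : p.trace = q.trace) :
    ‖p - q‖ ≤ 2 * ‖p * (1 - q)‖ := by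
  have := hp.norm_sub_sq hq h
  exact le_of_sq_le_sq (by nlinarith [sq_nonneg ‖p * (1 - q)‖]) (by positivity)

end IsOrthProj

/-! ### Moore–Penrose inverses of matrices of rank `r` -/

/-- `M` is the Moore–Penrose inverse of `R`, and the projections `R M` and `M R` have rank `r`. -/
structure IsPinv {l m : ℕ} (r : ℕ) (R : Matrix (Fin l) (Fin m) ℝ) (M : Matrix (Fin m) (Fin l) ℝ) :
    Prop where
  mul_mul_left : R * M * R = R
  mul_mul_right : M * R * M = M
  symm_left : (R * M)ᵀ = R * M
  symm_right : (M * R)ᵀ = M * R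
  trace_left : (R * M).trace = r

namespace IsPinv

variable {l m r : ℕ} {R S A B X : Matrix (Fin l) (Fin m) ℝ} {M N : Matrix (Fin m) (Fin l) ℝ}

lemma transpose (h : IsPinv r R M) : IsPinv r Rᵀ Mᵀ where
  mul_mul_left := by rw [← Matrix.transpose_mul, ← Matrix.transpose_mul, ← Matrix.mul_assoc,
    h.mul_mul_left]
  mul_mul_right := by rw [← Matrix.transpose_mul, ← Matrix.transpose_mul, ← Matrix.mul_assoc,
    h.mul_mul_right]
  symm_left := by rw [← Matrix.transpose_mul, h.symm_right, h.symm_right]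
  symm_right := by rw [← Matrix.transpose_mul, h.symm_left, h.symm_left]
  trace_left := by
    rw [← Matrix.transpose_mul, Matrix.trace_transpose, Matrix.trace_mul_comm, h.trace_left]

lemma trace_right (h : IsPinv r R M) : (M * R).trace = r := by
  rw [Matrix.trace_mul_comm, h.trace_left]

lemma orth_left (h : IsPinv r R M) : IsOrthProj (R * M) :=
  ⟨h.symm_left, by rw [← Matrix.mul_assoc, h.mul_mul_left]⟩

lemma orth_right (h : IsPinv r R M) : IsOrthProj (M * R) :=
  ⟨h.symm_right, by rw [← Matrix.mul_assoc, h.mul_mul_right]⟩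

lemma compl_mul_self (h : IsPinv r R M) : (1 - R * M) * R = 0 := by
  rw [Matrix.sub_mul, h.mul_mul_left, Matrix.one_mul, sub_self]

lemma self_mul_compl (h : IsPinv r R M) : R * (1 - M * R) = 0 := by
  rw [Matrix.mul_sub, ← Matrix.mul_assoc, h.mul_mul_left, Matrix.mul_one, sub_self]

/-- Since `S * (1 - N * S) = 0`, the factor `R` may be replaced by `R - S`. -/
lemma norm_right_mul_compl_le (_hR : IsPinv r R M) (hS : IsPinv r S N) :
    ‖M * R * (1 - N * S)‖ ≤ ‖M‖ * ‖R - S‖ := by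
  have : M * R * (1 - N * S) = M * ((R - S) * (1 - N * S)) := by
    rw [Matrix.sub_mul, hS.self_mul_compl, sub_zero, Matrix.mul_assoc]
  rw [this]
  exact (Matrix.frobenius_norm_mul _ _).trans
    (mul_le_mul_of_nonneg_left (hS.orth_right.compl.norm_mul_le' _) (norm_nonneg _))

lemma norm_left_mul_compl_le (hR : IsPinv r R M) (hS : IsPinv r S N) :
    ‖R * M * (1 - S * N)‖ ≤ ‖M‖ * ‖R - S‖ := by
  have := hR.transpose.norm_right_mul_compl_le hS.transpose
  rw [← Matrix.transpose_mul, ← Matrix.transpose_mul, hR.symm_left, hS.symm_left,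
    Matrix.frobenius_norm_transpose, ← Matrix.transpose_sub, Matrix.frobenius_norm_transpose] at this
  exact this

/-- The roles of the projections are exchanged, yet the constant is still `‖M‖`: nothing need be
known about `‖N‖`. -/
lemma norm_right_mul_compl_le' (hR : IsPinv r R M) (hS : IsPinv r S N) :
    ‖N * S * (1 - M * R)‖ ≤ ‖M‖ * ‖R - S‖ := by
  rw [hS.orth_right.norm_mul_compl_comm hR.orth_right (by rw [hS.trace_right, hR.trace_right])]
  exact hR.norm_right_mul_compl_le hS

lemma norm_left_sub_le (hR : IsPinv r R M) (hS : IsPinv r S N) :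
    ‖R * M - S * N‖ ≤ 2 * (‖M‖ * ‖R - S‖) :=
  (hR.orth_left.norm_sub_le hS.orth_left (by rw [hS.trace_left, hR.trace_left])).trans
    (by gcongr; exact hR.norm_left_mul_compl_le hS)

lemma norm_right_sub_le (hR : IsPinv r R M) (hS : IsPinv r S N) :
    ‖M * R - N * S‖ ≤ 2 * (‖M‖ * ‖R - S‖) :=
  (hR.orth_right.norm_sub_le hS.orth_right (by rw [hS.trace_right, hR.trace_right])).trans
    (by gcongr; exact hR.norm_right_mul_compl_le hS)

/-- The norm of the Moore–Penrose inverse is locally bounded on the matrices of rank `r`. -/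
lemma norm_le_two_mul (hR : IsPinv r R M) (hS : IsPinv r S N) (h : ‖M‖ * ‖R - S‖ ≤ 1 / 6) :
    ‖N‖ ≤ 2 * ‖M‖ := by
  -- The factor multiplying `N` in the last term is at most 1/6 + 2/6 = 1/2, so that term can be
  -- absorbed into the left-hand side.
  have e : N = M * (S * N) + (M * (R - S) - (M * R - N * S)) * N := by
    rw [Matrix.mul_sub, Matrix.sub_mul, Matrix.sub_mul, Matrix.sub_mul, hS.mul_mul_right,
      Matrix.mul_assoc M S N]
    abel
  have h1 : ‖M * (S * N)‖ ≤ ‖M‖ := hS.orth_left.norm_mul_le' _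
  have h2 : ‖(M * (R - S) - (M * R - N * S)) * N‖ ≤ 1 / 2 * ‖N‖ := by
    refine (Matrix.frobenius_norm_mul _ _).trans ?_
    gcongr
    refine (norm_sub_le _ _).trans ?_
    have := Matrix.frobenius_norm_mul M (R - S)
    have := hR.norm_right_sub_le hS
    linarith
  have h3 : ‖N‖ ≤ ‖M * (S * N)‖ + ‖(M * (R - S) - (M * R - N * S)) * N‖ := by
    conv_lhs => rw [e]
    exact norm_add_le _ _
  linarith

end IsPinv

/-- The orthogonal projection of `X` onto the tangent space at `R` of the matrices of rank `r`,
where `M` is the Moore–Penrose inverse of `R`. -/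
def tangentProj {l m : ℕ} (R : Matrix (Fin l) (Fin m) ℝ) (M : Matrix (Fin m) (Fin l) ℝ)
    (X : Matrix (Fin l) (Fin m) ℝ) : Matrix (Fin l) (Fin m) ℝ :=
  X - (1 - R * M) * X * (1 - M * R)

/-! ### Estimates for the tangential projection -/

section tangentProj

variable {l m r : ℕ} {R S A B X Y : Matrix (Fin l) (Fin m) ℝ} {M N : Matrix (Fin m) (Fin l) ℝ}

lemma tangentProj_sub (R : Matrix (Fin l) (Fin m) ℝ) (M : Matrix (Fin m) (Fin l) ℝ)
    (X Y : Matrix (Fin l) (Fin m) ℝ) :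
    tangentProj R M (X - Y) = tangentProj R M X - tangentProj R M Y := by
  simp only [tangentProj, Matrix.mul_sub (1 - R * M), Matrix.sub_mul ((1 - R * M) * X)]
  abel

lemma tangentProj_smul (R : Matrix (Fin l) (Fin m) ℝ) (M : Matrix (Fin m) (Fin l) ℝ)
    (c : ℝ) (X : Matrix (Fin l) (Fin m) ℝ) :
    tangentProj R M (c • X) = c • tangentProj R M X := by
  simp only [tangentProj, Matrix.mul_smul, Matrix.smul_mul, smul_sub]

lemma compl_mul_tangentProj_mul_compl (h : IsPinv r R M) (X : Matrix (Fin l) (Fin m) ℝ) :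
    (1 - R * M) * tangentProj R M X * (1 - M * R) = 0 := by
  have hp := h.orth_left.compl.idem
  have hq := h.orth_right.compl.idem
  unfold tangentProj
  generalize 1 - R * M = p at *
  generalize 1 - M * R = q at *
  rw [Matrix.mul_sub, Matrix.sub_mul, ← Matrix.mul_assoc, ← Matrix.mul_assoc, hp,
    Matrix.mul_assoc (p * X), hq, sub_self]

lemma norm_tangentProj_le (h : IsPinv r R M) (X : Matrix (Fin l) (Fin m) ℝ) :
    ‖tangentProj R M X‖ ≤ 2 * ‖X‖ := by
  have h1 := h.orth_right.compl.norm_mul_le' ((1 - R * M) * X)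
  have h2 := h.orth_left.compl.norm_mul_le X
  have h3 := norm_sub_le X ((1 - R * M) * X * (1 - M * R))
  unfold tangentProj
  linarith

lemma norm_tangentProj_sub_le (hR : IsPinv r R M) (hS : IsPinv r S N)
    (X : Matrix (Fin l) (Fin m) ℝ) :
    ‖tangentProj S N X - tangentProj R M X‖ ≤ 4 * ‖M‖ * ‖S - R‖ * ‖X‖ := by
  have e : tangentProj S N X - tangentProj R M X =
      (1 - R * M) * (X * (N * S - M * R)) - ((R * M - S * N) * X) * (1 - N * S) := by
    simp only [tangentProj, Matrix.mul_sub, Matrix.sub_mul, Matrix.one_mul, Matrix.mul_one,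
      Matrix.mul_assoc]
    abel
  rw [e]
  have h1 : ‖(1 - R * M) * (X * (N * S - M * R))‖ ≤ ‖X‖ * (2 * (‖M‖ * ‖R - S‖)) := by
    refine (hR.orth_left.compl.norm_mul_le _).trans ((Matrix.frobenius_norm_mul _ _).trans ?_)
    gcongr
    rw [norm_sub_rev]
    exact hR.norm_right_sub_le hS
  have h2 : ‖((R * M - S * N) * X) * (1 - N * S)‖ ≤ (2 * (‖M‖ * ‖R - S‖)) * ‖X‖ := by
    refine (hS.orth_right.compl.norm_mul_le' _).trans ((Matrix.frobenius_norm_mul _ _).trans ?_)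
    gcongr
    exact hR.norm_left_sub_le hS
  refine (norm_sub_le _ _).trans ?_
  rw [norm_sub_rev S R]
  linarith

/-- If the residual `A - B` of an approximation `B` of `A` of rank `r` is orthogonal to `B` and not
larger than `A - R`, then `B - R` is, to second order, the tangential part of `A - R`. -/
lemma norm_sub_sub_tangentProj_le (hR : IsPinv r R M) (hB : IsPinv r B N)
    (hl : B * N * (A - B) = 0) (hr : (A - B) * (N * B) = 0) (hle : ‖A - B‖ ≤ ‖A - R‖) :
    ‖B - R - tangentProj R M (A - R)‖ ≤ 8 * ‖M‖ * ‖A - R‖ ^ 2 := by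
  set ε := ‖A - R‖ with hε
  have hBR : ‖R - B‖ ≤ 2 * ε := by
    have := norm_sub_le (A - B) (A - R)
    rw [sub_sub_sub_cancel_left] at this
    linarith
  have hMB : ‖M‖ * ‖R - B‖ ≤ 2 * ‖M‖ * ε := by nlinarith [norm_nonneg M]
  have hl' : (1 - B * N) * (A - B) = A - B := by rw [Matrix.sub_mul, hl, Matrix.one_mul, sub_zero]
  have hr' : (A - B) * (1 - N * B) = A - B := by rw [Matrix.mul_sub, hr, Matrix.mul_one, sub_zero]
  -- The residual `A - B` minus its part normal to the tangent space at `R` is split into its left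
  -- part and the remaining right part. Each of the three terms is a product of two factors of order
  -- `ε`; the constants add up as 4 + 2 + 2 = 8.
  have e1 : B - R - tangentProj R M (A - R) =
      (1 - R * M) * B * (1 - M * R) - R * M * (A - B) - (1 - R * M) * ((A - B) * (M * R)) := by
    have : (1 - R * M) * (A - R) = (1 - R * M) * A := by
      rw [Matrix.mul_sub, hR.compl_mul_self, sub_zero]
    rw [tangentProj, this]
    simp only [Matrix.mul_sub, Matrix.sub_mul, Matrix.one_mul, Matrix.mul_one,
      Matrix.mul_assoc]
    abel
  -- The factor `1 - R * M` kills `R`, and `B = B * (N * B)` exposes a second small factor: the row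
  -- space of `B` seen from the complement of that of `R`.
  have e2 : (1 - R * M) * B * (1 - M * R) = (1 - R * M) * ((B - R) * (N * B * (1 - M * R))) := by
    have : (1 - R * M) * (B - R) = (1 - R * M) * B := by
      rw [Matrix.mul_sub, hR.compl_mul_self, sub_zero]
    have hB' : B * (N * B) = B := by rw [← Matrix.mul_assoc, hB.mul_mul_left]
    rw [← Matrix.mul_assoc, this, ← Matrix.mul_assoc _ (N * B), Matrix.mul_assoc _ B (N * B), hB']
  have b1 : ‖(1 - R * M) * B * (1 - M * R)‖ ≤ (2 * ε) * (2 * ‖M‖ * ε) := by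
    rw [e2]
    refine (hR.orth_left.compl.norm_mul_le _).trans ((Matrix.frobenius_norm_mul _ _).trans ?_)
    rw [norm_sub_rev B R]
    have := (hR.norm_right_mul_compl_le' hB).trans hMB
    gcongr
  -- The residual is orthogonal to the column space of `B`, which nearly coincides with that of `R`.
  have b2 : ‖R * M * (A - B)‖ ≤ (2 * ‖M‖ * ε) * ε := by
    rw [← hl', ← Matrix.mul_assoc]
    refine (Matrix.frobenius_norm_mul _ _).trans ?_
    have := (hR.norm_left_mul_compl_le hB).trans hMB
    gcongr
  have b3 : ‖(1 - R * M) * ((A - B) * (M * R))‖ ≤ ε * (2 * ‖M‖ * ε) := by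
    refine (hR.orth_left.compl.norm_mul_le _).trans ?_
    rw [← hr', Matrix.mul_assoc]
    refine (Matrix.frobenius_norm_mul _ _).trans ?_
    rw [hB.orth_right.norm_compl_mul hR.orth_right]
    have := (hR.norm_right_mul_compl_le hB).trans hMB
    gcongr
  rw [e1]
  have := norm_sub_le ((1 - R * M) * B * (1 - M * R) - R * M * (A - B))
    ((1 - R * M) * ((A - B) * (M * R)))
  have := norm_sub_le ((1 - R * M) * B * (1 - M * R)) (R * M * (A - B))
  nlinarith

end tangentProj

/-! ### Sums of rank one matrices -/

/-- The matrix `∑ i, a i • uᵢ vᵢᵀ`, where `uᵢ` and `vᵢ` are the columns of `U` and `V`. -/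
def diagSum {l m d : ℕ} (U : Matrix (Fin l) (Fin d) ℝ) (a : Fin d → ℝ)
    (V : Matrix (Fin m) (Fin d) ℝ) : Matrix (Fin l) (Fin m) ℝ :=
  U * Matrix.diagonal a * Vᵀ

section diagSum

variable {k l m d r : ℕ} {U : Matrix (Fin l) (Fin d) ℝ} {a b : Fin d → ℝ}
  {V : Matrix (Fin m) (Fin d) ℝ} {W : Matrix (Fin k) (Fin d) ℝ}

lemma sum_smul_vecMulVec_eq_diagSum (U : Matrix (Fin l) (Fin d) ℝ) (a : Fin d → ℝ)
    (V : Matrix (Fin m) (Fin d) ℝ) :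
    ∑ i, a i • Matrix.vecMulVec (U.col i) (V.col i) = diagSum U a V := by
  ext i j
  rw [diagSum, Matrix.mul_apply, Matrix.sum_apply]
  simp only [Matrix.smul_apply, Matrix.vecMulVec_apply, Matrix.col_apply,
    Matrix.transpose_apply, Matrix.mul_diagonal, smul_eq_mul]
  exact Finset.sum_congr rfl fun _ _ => by ring

lemma sum_filter_smul_vecMulVec_eq_diagSum (U : Matrix (Fin l) (Fin d) ℝ) (a : Fin d → ℝ)
    (V : Matrix (Fin m) (Fin d) ℝ) :
    ∑ i ∈ Finset.univ.filter (fun i : Fin d => (i : ℕ) < r),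
      a i • Matrix.vecMulVec (U.col i) (V.col i) =
    diagSum U (fun i => if (i : ℕ) < r then a i else 0) V := by
  rw [← sum_smul_vecMulVec_eq_diagSum, Finset.sum_filter]
  exact Finset.sum_congr rfl fun i _ => by split_ifs <;> simp

lemma transpose_diagSum (U : Matrix (Fin l) (Fin d) ℝ) (a : Fin d → ℝ)
    (V : Matrix (Fin m) (Fin d) ℝ) : (diagSum U a V)ᵀ = diagSum V a U := by
  simp [diagSum, Matrix.mul_assoc]

lemma diagSum_sub (U : Matrix (Fin l) (Fin d) ℝ) (a b : Fin d → ℝ) (V : Matrix (Fin m) (Fin d) ℝ) :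
    diagSum U a V - diagSum U b V = diagSum U (fun i => a i - b i) V := by
  rw [diagSum, diagSum, diagSum, ← Matrix.diagonal_sub, Matrix.mul_sub, Matrix.sub_mul]

lemma diagSum_mul (hV : Vᵀ * V = 1) (U : Matrix (Fin l) (Fin d) ℝ) (a b : Fin d → ℝ)
    (W : Matrix (Fin k) (Fin d) ℝ) :
    diagSum U a V * diagSum V b W = diagSum U (fun i => a i * b i) W := by
  rw [diagSum, diagSum, diagSum, ← Matrix.diagonal_mul_diagonal]
  simp only [Matrix.mul_assoc]
  rw [← Matrix.mul_assoc Vᵀ V, hV, Matrix.one_mul]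

lemma trace_diagSum (hV : Vᵀ * V = 1) (a : Fin d → ℝ) : (diagSum V a V).trace = ∑ i, a i := by
  rw [diagSum, Matrix.trace_mul_comm, ← Matrix.mul_assoc, hV, Matrix.one_mul, Matrix.trace_diagonal]

lemma norm_sq_diagSum (hU : Uᵀ * U = 1) (hV : Vᵀ * V = 1) (a : Fin d → ℝ) :
    ‖diagSum U a V‖ ^ 2 = ∑ i, a i ^ 2 := by
  rw [frobenius_norm_sq, transpose_diagSum, diagSum_mul hU, trace_diagSum hV]
  simp only [sq]

lemma isOrthProj_diagSum (hV : Vᵀ * V = 1) (ha : ∀ i, a i * a i = a i) :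
    IsOrthProj (diagSum V a V) where
  symm := transpose_diagSum _ _ _
  idem := by rw [diagSum_mul hV]; simp only [ha]

lemma isPinv_diagSum (hU : Uᵀ * U = 1) (hV : Vᵀ * V = 1) (ha : ∑ i, a i * (a i)⁻¹ = r) :
    IsPinv r (diagSum U a V) (diagSum V (fun i => (a i)⁻¹) U) where
  mul_mul_left := by
    rw [diagSum_mul hV, diagSum_mul hU]
    congr 1; ext i; exact mul_inv_mul_cancel (a i)
  mul_mul_right := by
    rw [diagSum_mul hU, diagSum_mul hV]
    congr 1; ext i; simpa using mul_inv_mul_cancel (a i)⁻¹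
  symm_left := by rw [diagSum_mul hV, transpose_diagSum]
  symm_right := by rw [diagSum_mul hU, transpose_diagSum]
  trace_left := by rw [diagSum_mul hV, trace_diagSum hU, ha]

lemma rank_diagSum (hU : Uᵀ * U = 1) (hV : Vᵀ * V = 1) (ha : ∀ i, a i ≠ 0) :
    (diagSum U a V).rank = d := by
  apply le_antisymm
  · rw [diagSum, Matrix.mul_assoc]
    exact (Matrix.rank_mul_le_left _ _).trans (Matrix.rank_le_width _)
  · have e : Uᵀ * (diagSum U a V * (V * Matrix.diagonal fun i => (a i)⁻¹)) = 1 := by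
      rw [diagSum, Matrix.mul_assoc _ Vᵀ, ← Matrix.mul_assoc Vᵀ V, hV, Matrix.one_mul,
        Matrix.mul_assoc, ← Matrix.mul_assoc, hU, Matrix.one_mul, Matrix.diagonal_mul_diagonal]
      simp [ha]
    calc d = (1 : Matrix (Fin d) (Fin d) ℝ).rank := by simp
      _ ≤ _ := by
        rw [← e]
        exact (Matrix.rank_mul_le_right _ _).trans (Matrix.rank_mul_le_left _ _)

lemma trace_mul_diagSum (q : Matrix (Fin m) (Fin m) ℝ) (a : Fin d → ℝ)
    (V : Matrix (Fin m) (Fin d) ℝ) :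
    (q * diagSum V a V).trace = ∑ i, a i * (Vᵀ * q * V) i i := by
  rw [diagSum, ← Matrix.mul_assoc, Matrix.trace_mul_comm, ← Matrix.mul_assoc,
    ← Matrix.mul_assoc, Matrix.trace]
  simp only [Matrix.diag, Matrix.mul_diagonal]
  exact Finset.sum_congr rfl fun _ _ => mul_comm _ _

end diagSum

/-! ### Diagonal weights of a projection in an orthonormal family -/

namespace IsOrthProj

variable {m d : ℕ} {q : Matrix (Fin m) (Fin m) ℝ} {V : Matrix (Fin m) (Fin d) ℝ}

lemma diag_nonneg (hq : IsOrthProj q) (V : Matrix (Fin m) (Fin d) ℝ) (i : Fin d) :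
    0 ≤ (Vᵀ * q * V) i i := by
  have : Vᵀ * q * V = (q * V)ᵀ * (q * V) := by
    rw [Matrix.transpose_mul, hq.symm, Matrix.mul_assoc Vᵀ q (q * V), ← Matrix.mul_assoc q q,
      hq.idem, Matrix.mul_assoc]
  rw [this, Matrix.mul_apply]
  exact Finset.sum_nonneg fun j _ => mul_self_nonneg _

lemma diag_le_one (hq : IsOrthProj q) (hV : Vᵀ * V = 1) (i : Fin d) : (Vᵀ * q * V) i i ≤ 1 := by
  have := hq.compl.diag_nonneg V i
  rw [Matrix.mul_sub, Matrix.sub_mul, Matrix.mul_one, hV, Matrix.sub_apply,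
    Matrix.one_apply_eq] at this
  linarith

/-- The sum is the trace of `q` times the projection onto the span of the columns of `V`, and it
falls short of `q.trace` by a squared norm. -/
lemma sum_diag_le (hq : IsOrthProj q) (hV : Vᵀ * V = 1) :
    ∑ i, (Vᵀ * q * V) i i ≤ q.trace := by
  have h := hq.norm_sq_mul_compl (isOrthProj_diagSum (a := fun _ => 1) hV (by simp))
  rw [trace_mul_diagSum] at h
  have := sq_nonneg ‖q * (1 - diagSum V (fun _ => 1) V)‖
  simp only [one_mul] at h
  linarith

end IsOrthProj

/-! ### Existence of singular value decompositions -/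

lemma exists_isSVD {l m : ℕ} (A : Matrix (Fin l) (Fin m) ℝ) :
    ∃ (d : ℕ) (σ : Fin d → ℝ) (U : Matrix (Fin l) (Fin d) ℝ) (V : Matrix (Fin m) (Fin d) ℝ),
      IsSVD A σ U V := by
  have hpsd : (Aᵀ * A).PosSemidef := by
    simpa [Matrix.conjTranspose_eq_transpose_of_trivial] using
      Matrix.posSemidef_conjTranspose_mul_self A
  have hG := hpsd.isHermitian
  set W : Matrix (Fin m) (Fin m) ℝ := hG.eigenvectorUnitary.1 with hW
  have hWW : Wᵀ * W = 1 := by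
    have := Unitary.coe_star_mul_self hG.eigenvectorUnitary
    rwa [Matrix.star_eq_conjTranspose, Matrix.conjTranspose_eq_transpose_of_trivial] at this
  have hWW' : W * Wᵀ = 1 := mul_eq_one_comm.mp hWW
  have hdiag : (A * W)ᵀ * (A * W) = Matrix.diagonal hG.eigenvalues := by
    have := hG.conjStarAlgAut_star_eigenvectorUnitary
    rw [Unitary.conjStarAlgAut_apply] at this
    simp only [Matrix.star_eq_conjTranspose, Matrix.conjTranspose_eq_transpose_of_trivial]
      at this
    rw [Matrix.transpose_mul, Matrix.mul_assoc, ← Matrix.mul_assoc Aᵀ, ← Matrix.mul_assoc]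
    exact this
  -- This is the equivalence by which `eigenvalues` is defined from the decreasing `eigenvalues₀`;
  -- it gives access to the ordering. The right singular vectors are the eigenvectors of `Aᵀ * A`
  -- with positive eigenvalue, and the left ones are the normalized columns of `A * W`.
  let e : Fin (Fintype.card (Fin m)) ≃ Fin m :=
    Fintype.equivOfCardEq (Fintype.card_fin (Fintype.card (Fin m)))
  have he : ∀ k, hG.eigenvalues (e k) = hG.eigenvalues₀ k := fun k => by
    simp [Matrix.IsHermitian.eigenvalues, e]
  let s : Finset (Fin (Fintype.card (Fin m))) := Finset.univ.filter fun k => 0 < hG.eigenvalues₀ k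
  let g : Fin s.card → Fin m := fun k => e (s.orderEmbOfFin rfl k)
  have hg : Function.Injective g := e.injective.comp (s.orderEmbOfFin rfl).injective
  have hgpos : ∀ k, 0 < hG.eigenvalues (g k) := fun k => by
    have := s.orderEmbOfFin_mem rfl k
    rw [he]
    exact (Finset.mem_filter.mp this).2
  have hgrange : ∀ k ∉ Set.range g, hG.eigenvalues k = 0 := fun k hk => by
    by_contra hne
    have hpos := lt_of_le_of_ne (hpsd.eigenvalues_nonneg k) (Ne.symm hne)
    have hks : e.symm k ∈ s := Finset.mem_filter.mpr ⟨Finset.mem_univ _, by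
      rw [← he, Equiv.apply_symm_apply]; exact hpos⟩
    rw [← Finset.mem_coe, ← Finset.range_orderEmbOfFin s rfl] at hks
    obtain ⟨i, hi⟩ := hks
    exact hk ⟨i, by simp [g, hi]⟩
  have hentry : ∀ i j, ∑ x, (A * W) x i * (A * W) x j =
      if i = j then hG.eigenvalues i else 0 := fun i j => by
    have := congrFun (congrFun hdiag i) j
    rwa [Matrix.mul_apply, Matrix.diagonal_apply] at this
  have hsq : ∀ k, √(hG.eigenvalues (g k)) ≠ 0 := fun k => (Real.sqrt_pos.mpr (hgpos k)).ne'
  refine ⟨s.card, fun k => √(hG.eigenvalues (g k)),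
    Matrix.of fun i k => (A * W) i (g k) / √(hG.eigenvalues (g k)),
    Matrix.of fun i k => W i (g k), fun k => Real.sqrt_pos.mpr (hgpos k), ?_, ?_, ?_, ?_⟩
  · intro i j hij
    apply Real.sqrt_le_sqrt
    rw [he, he]
    exact hG.eigenvalues₀_antitone ((s.orderEmbOfFin rfl).monotone hij)
  · ext i j
    simp only [Matrix.mul_apply, Matrix.transpose_apply, Matrix.of_apply]
    simp only [← Matrix.mul_apply, div_mul_div_comm]
    rw [← Finset.sum_div, hentry, Matrix.one_apply]
    by_cases hij : i = j
    · subst hij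
      simp only [if_true]
      rw [Real.mul_self_sqrt (hgpos i).le, div_self (hgpos i).ne']
    · rw [if_neg (fun h => hij (hg h)), if_neg hij, zero_div]
  · ext i j
    have := congrFun (congrFun hWW (g i)) (g j)
    simp only [Matrix.mul_apply, Matrix.transpose_apply, Matrix.one_apply, hg.eq_iff] at this
    simp only [Matrix.mul_apply, Matrix.transpose_apply, Matrix.of_apply, Matrix.one_apply, this]
  · rw [sum_smul_vecMulVec_eq_diagSum]
    have hA : A = (A * W) * Wᵀ := by rw [Matrix.mul_assoc, hWW', Matrix.mul_one]
    conv_lhs => rw [hA]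
    ext i j
    rw [diagSum, Matrix.mul_apply, Matrix.mul_apply]
    symm
    apply Fintype.sum_of_injective g hg
    -- A column of `A * W` with eigenvalue zero has squared norm zero, so dropping it loses nothing.
    · intro k hk
      have h0 := hentry k k
      rw [if_pos rfl, hgrange k hk,
        Finset.sum_eq_zero_iff_of_nonneg (fun _ _ => mul_self_nonneg _)] at h0
      rw [mul_self_eq_zero.mp (h0 i (Finset.mem_univ _)), zero_mul]
    · intro k
      rw [Matrix.mul_diagonal, Matrix.of_apply, div_mul_cancel₀ _ (hsq k)]
      rfl

/-! ### Truncated singular value decompositions -/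

lemma sum_ite_lt {d r : ℕ} (hr : r ≤ d) : ∑ i : Fin d, (if (i : ℕ) < r then (1 : ℝ) else 0) = r := by
  rw [Fin.sum_univ_eq_sum_range (fun i => if i < r then (1 : ℝ) else 0) d, ← Finset.sum_filter,
    Finset.sum_const, nsmul_eq_mul, mul_one]
  congr 1
  rw [show (Finset.range d).filter (· < r) = Finset.range r by ext; simp; omega]
  simp

/-- A threshold between the first `r` and the remaining values of a decreasing sequence. -/
lemma exists_threshold {d r : ℕ} (hr : r ≤ d) {a : Fin d → ℝ} (ha : Antitone a)
    (h0 : ∀ i, 0 < a i) :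
    ∃ s, 0 < s ∧ (∀ i : Fin d, (i : ℕ) < r → s ≤ a i) ∧ (∀ j : Fin d, r ≤ (j : ℕ) → a j ≤ s) ∧
      ((∀ i j : Fin d, (i : ℕ) < r → r ≤ (j : ℕ) → a j < a i) →
        ∀ j : Fin d, r ≤ (j : ℕ) → a j < s) := by
  rcases Nat.eq_zero_or_pos r with rfl | hpos
  -- For `r = 0` there is no `r`-th value, and any number above all the values serves. Otherwise the
  -- threshold is the `r`-th value, of index `r - 1`.
  · have hs : ∀ j, a j < 1 + ∑ i, a i := fun j => by
      have := Finset.single_le_sum (fun i _ => (h0 i).le) (Finset.mem_univ j)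
      linarith
    have hs0 := Finset.sum_nonneg fun i (_ : i ∈ Finset.univ) => (h0 i).le
    exact ⟨1 + ∑ i, a i, by linarith, fun i hi => absurd hi (by omega), fun j _ => (hs j).le,
      fun _ j _ => hs j⟩
  · let k : Fin d := ⟨r - 1, by omega⟩
    refine ⟨a k, h0 k, fun i hi => ha ?_, fun j hj => ha ?_, fun h j hj => h k j ?_ hj⟩
    · rw [Fin.le_def]; show (i : ℕ) ≤ r - 1; omega
    · rw [Fin.le_def]; show r - 1 ≤ (j : ℕ); omega
    · show r - 1 < r; omega

/-- A rearrangement inequality, with its case of equality. -/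
lemma sum_mul_le_sum_ite {d r : ℕ} (hr : r ≤ d) {a w : Fin d → ℝ} (ha : Antitone a)
    (h0 : ∀ i, 0 < a i) (hw0 : ∀ i, 0 ≤ w i) (hw1 : ∀ i, w i ≤ 1) (hw : ∑ i, w i ≤ r) :
    ∑ i, a i * w i ≤ ∑ i : Fin d, (if (i : ℕ) < r then a i else 0) ∧
    ((∀ i j : Fin d, (i : ℕ) < r → r ≤ (j : ℕ) → a j < a i) →
      ∑ i, a i * w i = ∑ i : Fin d, (if (i : ℕ) < r then a i else 0) →
      ∀ i, w i = if (i : ℕ) < r then 1 else 0) := by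
  obtain ⟨s, hs, hs1, hs2, hs3⟩ := exists_threshold hr ha h0
  set c : Fin d → ℝ := fun i => if (i : ℕ) < r then 1 else 0 with hc
  have hsum : ∑ i, c i = r := sum_ite_lt hr
  have hterm : ∀ i, 0 ≤ (a i - s) * (c i - w i) := fun i => by
    by_cases hi : (i : ℕ) < r
    · simp only [hc, if_pos hi]
      exact mul_nonneg (sub_nonneg.mpr (hs1 i hi)) (sub_nonneg.mpr (hw1 i))
    · simp only [hc, if_neg hi]
      nlinarith [hs2 i (not_lt.mp hi), hw0 i]
  have hite : ∑ i : Fin d, (if (i : ℕ) < r then a i else 0) = ∑ i, a i * c i :=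
    Finset.sum_congr rfl fun i _ => by simp [hc]
  -- Subtracting the threshold `s` makes every summand nonnegative; the correction is nonnegative
  -- because the weights sum to at most `r`.
  have hid : ∑ i, a i * c i - ∑ i, a i * w i =
      ∑ i, (a i - s) * (c i - w i) + s * (r - ∑ i, w i) := by
    rw [← hsum, ← Finset.sum_sub_distrib, ← Finset.sum_sub_distrib, Finset.mul_sum,
      ← Finset.sum_add_distrib]
    exact Finset.sum_congr rfl fun _ _ => by ring
  have hnn := Finset.sum_nonneg fun i (_ : i ∈ Finset.univ) => hterm i
  have hnn' : 0 ≤ s * (r - ∑ i, w i) := mul_nonneg hs.le (sub_nonneg.mpr hw)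
  rw [hite]
  refine ⟨by linarith, fun hgap heq => ?_⟩
  have hz : ∑ i, (a i - s) * (c i - w i) = 0 := by linarith
  have hz' : ∑ i, w i = r := by
    have : s * (r - ∑ i, w i) = 0 := by linarith
    rcases mul_eq_zero.mp this with h | h
    · exact absurd h hs.ne'
    · linarith
  rw [Finset.sum_eq_zero_iff_of_nonneg fun i _ => hterm i] at hz
  -- Only beyond index `r` is `a i - s` known to be nonzero, since `s` is itself attained when `r >
  -- 0`. The first `r` weights are recovered afterwards from the total.
  have htail : ∀ i : Fin d, r ≤ (i : ℕ) → w i = 0 := fun i hi => by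
    have := hz i (Finset.mem_univ _)
    simp only [hc, if_neg (not_lt.mpr hi)] at this
    rcases mul_eq_zero.mp this with h | h
    · exact absurd h (sub_neg.mpr (hs3 hgap i hi)).ne
    · linarith
  have hnonneg : ∀ i ∈ Finset.univ, 0 ≤ c i - w i := fun i _ => by
    by_cases hi : (i : ℕ) < r
    · simp only [hc, if_pos hi]
      exact sub_nonneg.mpr (hw1 i)
    · simp [hc, if_neg hi, htail i (not_lt.mp hi)]
  have : ∑ i, (c i - w i) = 0 := by rw [Finset.sum_sub_distrib, hsum, hz', sub_self]
  intro i
  have := (Finset.sum_eq_zero_iff_of_nonneg hnonneg).mp this i (Finset.mem_univ i)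
  show w i = c i
  linarith

namespace IsSVD

variable {l m d r : ℕ} {A : Matrix (Fin l) (Fin m) ℝ} {σ : Fin d → ℝ}
  {U : Matrix (Fin l) (Fin d) ℝ} {V : Matrix (Fin m) (Fin d) ℝ}

lemma eq_diagSum (h : IsSVD A σ U V) : A = diagSum U σ V := by
  rw [h.eq_sum, sum_smul_vecMulVec_eq_diagSum]

lemma rank_eq (h : IsSVD A σ U V) : A.rank = d := by
  rw [h.eq_diagSum, rank_diagSum h.left_orthonormal h.right_orthonormal fun i => (h.pos i).ne']

lemma sq_antitone (h : IsSVD A σ U V) : Antitone fun i => σ i ^ 2 :=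
  fun _ _ hij => pow_le_pow_left₀ (h.pos _).le (h.anti hij) 2

lemma sum_ite_mul_inv (h : IsSVD A σ U V) (hr : r ≤ d) :
    ∑ i : Fin d, (if (i : ℕ) < r then σ i else 0) * (if (i : ℕ) < r then σ i else 0)⁻¹ = r := by
  rw [← sum_ite_lt hr]
  refine Finset.sum_congr rfl fun i _ => ?_
  split_ifs
  · exact mul_inv_cancel₀ (h.pos i).ne'
  · simp

/-- This reduces Eckart–Young to the rearrangement inequality: the diagonal entries are weights in
[0, 1] with sum at most the rank of `q`. -/
lemma norm_sq_mul_compl (h : IsSVD A σ U V) {q : Matrix (Fin m) (Fin m) ℝ} (hq : IsOrthProj q) :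
    ‖A * (1 - q)‖ ^ 2 = ∑ i, σ i ^ 2 - ∑ i, σ i ^ 2 * (Vᵀ * q * V) i i := by
  have e : ‖A * (1 - q)‖ ^ 2 = ‖A‖ ^ 2 - (q * (Aᵀ * A)).trace := by
    rw [← Matrix.frobenius_norm_transpose, Matrix.transpose_mul, hq.compl.symm,
      hq.compl.norm_sq_mul, Matrix.transpose_transpose, frobenius_norm_sq, Matrix.trace_mul_comm,
      ← Matrix.mul_assoc, Matrix.mul_sub, Matrix.mul_one, Matrix.trace_sub,
      Matrix.trace_mul_comm _ q]
  rw [e, h.eq_diagSum, norm_sq_diagSum h.left_orthonormal h.right_orthonormal, transpose_diagSum,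
    diagSum_mul h.left_orthonormal, trace_mul_diagSum]
  simp only [sq]

lemma sub_truncation (h : IsSVD A σ U V) :
    A - diagSum U (fun i => if (i : ℕ) < r then σ i else 0) V =
      diagSum U (fun i => if (i : ℕ) < r then 0 else σ i) V := by
  rw [h.eq_diagSum, diagSum_sub]
  congr 1; ext i; split_ifs <;> simp

lemma norm_sq_sub_truncation (h : IsSVD A σ U V) :
    ‖A - diagSum U (fun i => if (i : ℕ) < r then σ i else 0) V‖ ^ 2 =
      ∑ i, σ i ^ 2 - ∑ i : Fin d, (if (i : ℕ) < r then σ i ^ 2 else 0) := by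
  rw [h.sub_truncation, norm_sq_diagSum h.left_orthonormal h.right_orthonormal,
    ← Finset.sum_sub_distrib]
  exact Finset.sum_congr rfl fun i _ => by split_ifs <;> simp

/-- The Eckart–Young theorem. -/
lemma norm_sub_truncation_le (h : IsSVD A σ U V) (hr : r ≤ d) {q : Matrix (Fin m) (Fin m) ℝ}
    (hq : IsOrthProj q) (hqr : q.trace = r) :
    ‖A - diagSum U (fun i => if (i : ℕ) < r then σ i else 0) V‖ ≤ ‖A * (1 - q)‖ := by
  refine le_of_sq_le_sq ?_ (norm_nonneg _)
  rw [h.norm_sq_sub_truncation, h.norm_sq_mul_compl hq]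
  have := (sum_mul_le_sum_ite hr h.sq_antitone (fun i => pow_pos (h.pos i) 2)
    (hq.diag_nonneg V) (hq.diag_le_one h.right_orthonormal)
    ((hq.sum_diag_le h.right_orthonormal).trans hqr.le)).1
  linarith

/-- The case of equality in the Eckart–Young theorem. -/
lemma mul_eq_truncation (h : IsSVD A σ U V) (hr : r ≤ d)
    (hgap : ∀ i j : Fin d, (i : ℕ) < r → r ≤ (j : ℕ) → σ j < σ i)
    {q : Matrix (Fin m) (Fin m) ℝ} (hq : IsOrthProj q) (hqr : q.trace = r)
    (hle : ‖A * (1 - q)‖ ≤ ‖A - diagSum U (fun i => if (i : ℕ) < r then σ i else 0) V‖) :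
    A * q = diagSum U (fun i => if (i : ℕ) < r then σ i else 0) V := by
  have heq := hle.antisymm (h.norm_sub_truncation_le hr hq hqr)
  have heq2 := congrArg (· ^ 2) heq
  beta_reduce at heq2
  rw [h.norm_sq_sub_truncation, h.norm_sq_mul_compl hq] at heq2
  have hw := (sum_mul_le_sum_ite hr h.sq_antitone (fun i => pow_pos (h.pos i) 2)
    (hq.diag_nonneg V) (hq.diag_le_one h.right_orthonormal)
    ((hq.sum_diag_le h.right_orthonormal).trans hqr.le)).2
    (fun i j hi hj => pow_lt_pow_left₀ (hgap i j hi hj) (h.pos j).le two_ne_zero) (by linarith)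
  set c : Fin d → ℝ := fun i => if (i : ℕ) < r then 1 else 0 with hc
  have hcc : ∀ i, c i * c i = c i := fun i => by simp only [hc]; split_ifs <;> simp
  have hp := isOrthProj_diagSum h.right_orthonormal hcc
  have htr : (diagSum V c V).trace = r := by
    rw [trace_diagSum h.right_orthonormal, hc, sum_ite_lt hr]
  -- Equality forces the weights to be `c`. The two projections then have equal trace, which is also
  -- the trace of their product, so their distance is zero.
  have hqp : q = diagSum V c V := by
    have := hq.norm_sub_sq hp (hqr.trans htr.symm)
    rw [hq.norm_sq_mul_compl hp, trace_mul_diagSum, hqr, ← htr, trace_diagSum h.right_orthonormal]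
      at this
    have e : ∑ i, c i * (Vᵀ * q * V) i i = ∑ i, c i :=
      Finset.sum_congr rfl fun i _ => by rw [hw i]; exact hcc i
    rw [e, sub_self, mul_zero] at this
    exact sub_eq_zero.mp (norm_eq_zero.mp (pow_eq_zero_iff two_ne_zero |>.mp this))
  conv_lhs => rw [hqp, h.eq_diagSum]
  rw [diagSum_mul h.right_orthonormal]
  congr 1; ext i; simp [hc]

end IsSVD

/-- A matrix of rank `r` has a Moore–Penrose inverse. -/
lemma exists_isPinv_of_rank_eq {l m r : ℕ} {R : Matrix (Fin l) (Fin m) ℝ} (h : R.rank = r) :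
    ∃ M, IsPinv r R M := by
  obtain ⟨d, σ, U, V, hs⟩ := exists_isSVD R
  have hd : d = r := by rw [← h, hs.rank_eq]
  refine ⟨diagSum V (fun i => (σ i)⁻¹) U, ?_⟩
  rw [hs.eq_diagSum]
  refine isPinv_diagSum hs.left_orthonormal hs.right_orthonormal ?_
  rw [← hd]
  simp [fun i => mul_inv_cancel₀ (hs.pos i).ne']

/-- A truncated singular value decomposition has rank `r`, its residual is orthogonal to it, and it is
a best approximation of rank `r`. -/
lemma IsTruncatedSVD.exists_isPinv {l m r : ℕ} {A B : Matrix (Fin l) (Fin m) ℝ}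
    (h : IsTruncatedSVD r A B) :
    ∃ N, IsPinv r B N ∧ B * N * (A - B) = 0 ∧ (A - B) * (N * B) = 0 ∧
      ∀ {R : Matrix (Fin l) (Fin m) ℝ} {M}, IsPinv r R M → ‖A - B‖ ≤ ‖A - R‖ := by
  obtain ⟨d, σ, U, V, hs, hr, -, rfl⟩ := h
  rw [sum_filter_smul_vecMulVec_eq_diagSum]
  refine ⟨_, isPinv_diagSum hs.left_orthonormal hs.right_orthonormal (hs.sum_ite_mul_inv hr), ?_, ?_,
    fun {R M} hR => ?_⟩
  · rw [hs.sub_truncation, diagSum_mul hs.right_orthonormal, diagSum_mul hs.left_orthonormal]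
    rw [show (fun i : Fin d => _ * _ * _) = fun _ => (0 : ℝ) by ext i; split_ifs <;> simp]
    simp [diagSum]
  · rw [hs.sub_truncation, diagSum_mul hs.left_orthonormal, diagSum_mul hs.right_orthonormal]
    rw [show (fun i : Fin d => _ * (_ * _)) = fun _ => (0 : ℝ) by ext i; split_ifs <;> simp]
    simp [diagSum]
  · refine (hs.norm_sub_truncation_le hr hR.orth_right hR.trace_right).trans ?_
    have : A * (1 - M * R) = (A - R) * (1 - M * R) := by
      rw [Matrix.sub_mul, hR.self_mul_compl, sub_zero]
    rw [this]
    exact hR.orth_right.compl.norm_mul_le' _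

/-- The second truncation is `A * q`, with `q` the projection onto its row space, and it is also a
best approximation. The equality case of Eckart–Young for the first decomposition then identifies
them. -/
lemma IsTruncatedSVD.unique {l m r : ℕ} {A B B' : Matrix (Fin l) (Fin m) ℝ}
    (h : IsTruncatedSVD r A B) (h' : IsTruncatedSVD r A B') : B = B' := by
  obtain ⟨N, hB, -, -, hle⟩ := h.exists_isPinv
  obtain ⟨N', hB', -, hres, hle'⟩ := h'.exists_isPinv
  obtain ⟨d, σ, U, V, hs, hr, hgap, rfl⟩ := h
  rw [sum_filter_smul_vecMulVec_eq_diagSum] at hB hle ⊢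
  have e : A * (N' * B') = B' := by
    rw [Matrix.sub_mul, ← Matrix.mul_assoc B', hB'.mul_mul_left, sub_eq_zero] at hres
    exact hres
  rw [← hs.mul_eq_truncation hr hgap hB'.orth_right hB'.trace_right ?_, e]
  rw [Matrix.mul_sub, Matrix.mul_one, e]
  exact hle' hB

/-- The squared norm is `p.trace - (p * q).trace`, and `(p * q).trace` is at most `q.trace`. -/
lemma IsOrthProj.one_le_norm_mul_compl {m : ℕ} {p q : Matrix (Fin m) (Fin m) ℝ}
    (hp : IsOrthProj p) (hq : IsOrthProj q) (h : q.trace + 1 ≤ p.trace) : 1 ≤ ‖p * (1 - q)‖ := by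
  have h1 := hp.norm_sq_mul_compl hq
  have h2 := hq.norm_sq_mul_compl hp
  rw [Matrix.trace_mul_comm q p] at h2
  have := sq_nonneg ‖q * (1 - p)‖
  exact le_of_sq_le_sq (by linarith) (norm_nonneg _)

/-- A matrix close to a matrix of rank `r` has a truncated singular value decomposition. -/
lemma exists_isTruncatedSVD {l m r : ℕ} {A R : Matrix (Fin l) (Fin m) ℝ}
    {M : Matrix (Fin m) (Fin l) ℝ} (hR : IsPinv r R M) (h : ‖M‖ * ‖A - R‖ < 1 / 3) :
    ∃ B, IsTruncatedSVD r A B := by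
  obtain ⟨d, σ, U, V, hs⟩ := exists_isSVD A
  -- A projection `c` onto fewer than `r` right singular vectors cannot cover the row space of `R`,
  -- so `A` must retain a sizeable part outside it.
  have key : ∀ c : Fin d → ℝ, (∀ i, c i * c i = c i) → ∑ i, c i + 1 ≤ r →
      1 ≤ ‖M‖ * (‖A - R‖ + ‖diagSum U (fun i => σ i * (1 - c i)) V‖) := fun c hc hcr => by
    have hq := isOrthProj_diagSum hs.right_orthonormal hc
    have h1 := hR.orth_right.one_le_norm_mul_compl hq
      (by rwa [trace_diagSum hs.right_orthonormal, hR.trace_right])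
    have eA : A * (1 - diagSum V c V) = diagSum U (fun i => σ i * (1 - c i)) V := by
      rw [Matrix.mul_sub, Matrix.mul_one]
      nth_rw 1 2 [hs.eq_diagSum]
      rw [diagSum_mul hs.right_orthonormal, diagSum_sub]
      congr 1; ext i; ring
    have e : M * R * (1 - diagSum V c V) =
        M * (diagSum U (fun i => σ i * (1 - c i)) V - (A - R) * (1 - diagSum V c V)) := by
      rw [← eA, ← Matrix.sub_mul, sub_sub_cancel, Matrix.mul_assoc]
    rw [e] at h1
    refine h1.trans ((Matrix.frobenius_norm_mul _ _).trans ?_)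
    gcongr
    refine (norm_sub_le _ _).trans ?_
    have := hq.compl.norm_mul_le' (A - R)
    linarith
  have hr : r ≤ d := by
    by_contra hlt
    have := key (fun _ => 1) (by simp) (by
      simp only [Finset.sum_const, Finset.card_univ, Fintype.card_fin, nsmul_eq_mul, mul_one]
      exact_mod_cast not_le.mp hlt)
    simp only [sub_self, mul_zero] at this
    rw [show diagSum U (fun _ => 0) V = 0 by simp [diagSum], norm_zero, add_zero] at this
    linarith
  have htail : ‖A - diagSum U (fun i => if (i : ℕ) < r then σ i else 0) V‖ ≤ ‖A - R‖ := by
    refine (hs.norm_sub_truncation_le hr hR.orth_right hR.trace_right).trans ?_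
    have : A * (1 - M * R) = (A - R) * (1 - M * R) := by
      rw [Matrix.sub_mul, hR.self_mul_compl, sub_zero]
    rw [this]
    exact hR.orth_right.compl.norm_mul_le' _
  refine ⟨_, d, σ, U, V, hs, hr, fun i j hi hj => ?_, rfl⟩
  -- Without a gap, `σ i ≤ σ j ≤ ‖A - R‖`. Removing index `i` from the first `r` leaves rank `r - 1`
  -- and a tail of norm at most `2 * ‖A - R‖`. Then `key` gives `1 ≤ 3 * ‖M‖ * ‖A - R‖`, which
  -- explains the constant 1/3.
  by_contra hle
  have hj' : σ j ≤ ‖A - R‖ := by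
    refine le_trans (le_of_sq_le_sq ?_ (norm_nonneg _)) htail
    rw [hs.sub_truncation, norm_sq_diagSum hs.left_orthonormal hs.right_orthonormal]
    have := Finset.single_le_sum (f := fun i : Fin d => (if (i : ℕ) < r then 0 else σ i) ^ 2)
      (fun i _ => sq_nonneg _) (Finset.mem_univ j)
    simpa only [if_neg (not_lt.mpr hj)] using this
  have hi' := (not_lt.mp hle).trans hj'
  have hk := key (fun k => if (k : ℕ) < r ∧ k ≠ i then 1 else 0)
    (fun k => by split_ifs <;> simp) (by
      have hsum : ∑ k : Fin d, ((if (k : ℕ) < r then (1 : ℝ) else 0) - if k = i then 1 else 0) =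
          r - 1 := by
        rw [Finset.sum_sub_distrib, sum_ite_lt hr]
        simp
      rw [← le_sub_iff_add_le, ← hsum]
      refine Finset.sum_le_sum fun k _ => ?_
      by_cases hk : k = i
      · subst hk; simp [hi]
      · simp [hk])
  have e : diagSum U (fun k => σ k * (1 - if (k : ℕ) < r ∧ k ≠ i then 1 else 0)) V =
      diagSum U (fun k => if (k : ℕ) < r then 0 else σ k) V -
        diagSum U (fun k => if k = i then - σ k else 0) V := by
    rw [diagSum_sub]
    congr 1; ext k
    by_cases hk : k = i
    · subst hk; simp [hi]
    · simp [hk]; split_ifs <;> simp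
  have n : ‖diagSum U (fun k => if k = i then - σ k else 0) V‖ = σ i := by
    refine (sq_eq_sq₀ (norm_nonneg _) (hs.pos i).le).mp ?_
    rw [norm_sq_diagSum hs.left_orthonormal hs.right_orthonormal]
    simp
  rw [e, ← hs.sub_truncation] at hk
  have h3 := norm_sub_le (A - diagSum U (fun i => if (i : ℕ) < r then σ i else 0) V)
    (diagSum U (fun k => if k = i then - σ k else 0) V)
  rw [n] at h3
  have : ‖M‖ * (‖A - R‖ + ‖A - diagSum U (fun i => if (i : ℕ) < r then σ i else 0) V -
    diagSum U (fun k => if k = i then - σ k else 0) V‖) ≤ ‖M‖ * (3 * ‖A - R‖) := by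
    gcongr
    linarith
  linarith

/-! ### The tangent spaces of the manifold of matrices of rank `r` -/

section tangentSpace

variable {l m r : ℕ} {R X Y : Matrix (Fin l) (Fin m) ℝ} {M : Matrix (Fin m) (Fin l) ℝ}

/-- The map `X ↦ P X Q` as a linear map. -/
def mulMulLin {l m : ℕ} (P : Matrix (Fin l) (Fin l) ℝ) (Q : Matrix (Fin m) (Fin m) ℝ) :
    Matrix (Fin l) (Fin m) ℝ →ₗ[ℝ] Matrix (Fin l) (Fin m) ℝ where
  toFun X := P * X * Q
  map_add' X Y := by rw [Matrix.mul_add, Matrix.add_mul]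
  map_smul' c X := by rw [Matrix.mul_smul, Matrix.smul_mul, RingHom.id_apply]

/-- The map `X ↦ P X Q` as a continuous linear map. -/
def mulMulCLM {l m : ℕ} (P : Matrix (Fin l) (Fin l) ℝ) (Q : Matrix (Fin m) (Fin m) ℝ) :
    Matrix (Fin l) (Fin m) ℝ →L[ℝ] Matrix (Fin l) (Fin m) ℝ :=
  ⟨mulMulLin P Q, by
    show Continuous fun X => P * X * Q
    fun_prop⟩

lemma mulMulCLM_apply (P : Matrix (Fin l) (Fin l) ℝ) (Q : Matrix (Fin m) (Fin m) ℝ)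
    (X : Matrix (Fin l) (Fin m) ℝ) : mulMulCLM P Q X = P * X * Q := rfl

/-- Along a curve of matrices of rank `r`, the normal component is quadratic in `γ t - R`, so its
derivative at 0 vanishes. -/
lemma compl_mul_mul_compl_of_mem_tangentSpaceAt (hR : IsPinv r R M) (hX : X ∈ tangentSpaceAt r R) :
    (1 - R * M) * X * (1 - M * R) = 0 := by
  obtain ⟨ε, γ, hε, -, hγ, h0, hd⟩ := hX
  set Λ := mulMulCLM (1 - R * M) (1 - M * R) with hΛ
  have h1 : HasDerivAt (fun t => Λ (γ t)) (Λ X) 0 := Λ.hasFDerivAt.comp_hasDerivAt 0 hd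
  have hbound : ∀ t ∈ Ioo (-ε) ε, ‖Λ (γ t)‖ ≤ ‖M‖ * ‖‖γ t - R‖ * ‖γ t - R‖‖ := fun t ht => by
    obtain ⟨N, hN⟩ := exists_isPinv_of_rank_eq (hγ t ht)
    have e : Λ (γ t) = (1 - R * M) * ((γ t - R) * (N * γ t * (1 - M * R))) := by
      have e1 : (1 - R * M) * (γ t - R) = (1 - R * M) * γ t := by
        rw [Matrix.mul_sub, hR.compl_mul_self, sub_zero]
      have e2 : γ t * (N * γ t) = γ t := by rw [← Matrix.mul_assoc, hN.mul_mul_left]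
      rw [hΛ, mulMulCLM_apply, ← Matrix.mul_assoc (1 - R * M) (γ t - R), e1,
        ← Matrix.mul_assoc _ (N * γ t), Matrix.mul_assoc _ (γ t) (N * γ t), e2]
    rw [e]
    refine (hR.orth_left.compl.norm_mul_le _).trans ((Matrix.frobenius_norm_mul _ _).trans ?_)
    have := hR.norm_right_mul_compl_le' hN
    rw [norm_sub_rev R] at this
    rw [Real.norm_of_nonneg (mul_nonneg (norm_nonneg (γ t - R)) (norm_nonneg (γ t - R)))]
    calc ‖γ t - R‖ * ‖N * γ t * (1 - M * R)‖ ≤ ‖γ t - R‖ * (‖M‖ * ‖γ t - R‖) := by gcongr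
      _ = _ := by ring
  have hΛ0 : Λ (γ 0) = 0 := by
    have := hbound 0 (by simp [hε])
    rw [h0] at this ⊢
    simpa using this
  have h2 : HasDerivAt (fun t => Λ (γ t)) 0 0 := by
    refine hasDerivAt_iff_isLittleO.mpr ?_
    simp only [hΛ0, sub_zero, smul_zero]
    have hO : (fun t => γ t - R) =O[𝓝 0] fun t : ℝ => t := by
      simpa [h0] using hd.isBigO_sub
    have ho : (fun t => γ t - R) =o[𝓝 0] fun _ : ℝ => (1 : ℝ) := by
      rw [Asymptotics.isLittleO_one_iff]
      have := hd.continuousAt.tendsto.sub_const R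
      simpa [h0] using this
    have hoo := hO.norm_left.mul_isLittleO ho.norm_left
    simp only [mul_one] at hoo
    refine Asymptotics.IsBigO.trans_isLittleO (Asymptotics.IsBigO.of_bound ‖M‖ ?_) hoo
    filter_upwards [Ioo_mem_nhds (neg_lt_zero.mpr hε) hε] with t ht using hbound t ht
  exact h1.unique h2

/-- The curve `(1 + t • W) * R * (1 + t • Z)` has velocity `W * R + R * Z = Y` at 0, and keeps rank
`r` as long as the outer factors are invertible. -/
lemma mem_tangentSpaceAt_of_compl_mul_mul_compl (hRr : R.rank = r)
    (hY : (1 - R * M) * Y * (1 - M * R) = 0) : Y ∈ tangentSpaceAt r R := by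
  set W := (1 - R * M) * Y * M
  set Z := M * Y
  have hW : Continuous fun t : ℝ => (1 + t • W).det := by
    apply Continuous.matrix_det
    fun_prop
  have hZ : Continuous fun t : ℝ => (1 + t • Z).det := by
    apply Continuous.matrix_det
    fun_prop
  have hev : ∀ᶠ t : ℝ in 𝓝 0, (1 + t • W).det ≠ 0 ∧ (1 + t • Z).det ≠ 0 :=
    (hW.continuousAt.eventually_ne (by simp)).and (hZ.continuousAt.eventually_ne (by simp))
  obtain ⟨ε, hε, hball⟩ := Metric.eventually_nhds_iff.mp hev
  have hform : ∀ t : ℝ, R + t • Y + (t ^ 2) • (W * R * Z) = (1 + t • W) * R * (1 + t • Z) := by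
    intro t
    have e : W * R + R * Z = Y := by
      simp only [W, Z]
      rw [← sub_eq_zero, ← neg_eq_zero, ← hY]
      simp only [Matrix.mul_sub, Matrix.sub_mul, Matrix.one_mul, Matrix.mul_one, Matrix.mul_assoc]
      abel
    conv_lhs => rw [← e]
    simp only [Matrix.add_mul, Matrix.mul_add, Matrix.one_mul, Matrix.mul_one, Matrix.smul_mul,
      Matrix.mul_smul, smul_add, smul_smul, sq]
    abel
  refine ⟨ε, fun t => R + t • Y + (t ^ 2) • (W * R * Z), hε, ?_, fun t ht => ?_, by simp, ?_⟩
  · apply ContDiff.contDiffOn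
    fun_prop
  · obtain ⟨h1, h2⟩ := hball (y := t) (by rw [Real.dist_eq, sub_zero, abs_lt]; exact ht)
    show Matrix.rank (R + t • Y + (t ^ 2) • (W * R * Z)) = r
    rw [hform, Matrix.rank_mul_eq_left_of_isUnit_det _ _ (isUnit_iff_ne_zero.mpr h2),
      Matrix.rank_mul_eq_right_of_isUnit_det _ _ (isUnit_iff_ne_zero.mpr h1), hRr]
  · have h1 := ((hasDerivAt_id (0 : ℝ)).smul_const Y).const_add R
    have h2 := (((hasDerivAt_id (0 : ℝ)).pow 2).smul_const (W * R * Z))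
    have h3 := h1.add h2
    simp only [one_smul, id_eq] at h3
    convert! h3 using 1
    simp

/-- The difference `Y` of the two candidates is itself tangent, hence orthogonal to `X - P`. As `X -
P` is `Y` plus a normal matrix, `Y` is orthogonal to itself. -/
lemma IsTangentProjection.eq_tangentProj {P : Matrix (Fin l) (Fin m) ℝ} (hRr : R.rank = r)
    (hR : IsPinv r R M) (h : IsTangentProjection r R X P) : P = tangentProj R M X := by
  obtain ⟨hP, horth⟩ := h
  have hP0 := compl_mul_mul_compl_of_mem_tangentSpaceAt hR hP
  set Y := tangentProj R M X - P with hYdef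
  have hY0 : (1 - R * M) * Y * (1 - M * R) = 0 := by
    rw [hYdef, Matrix.mul_sub (1 - R * M), Matrix.sub_mul ((1 - R * M) * _), hP0,
      compl_mul_tangentProj_mul_compl hR, sub_zero]
  have h1 := horth Y (mem_tangentSpaceAt_of_compl_mul_mul_compl hRr hY0)
  have e : X - P = Y + (1 - R * M) * X * (1 - M * R) := by
    rw [hYdef, tangentProj]; abel
  have h2 : (((1 - R * M) * X * (1 - M * R))ᵀ * Y).trace = 0 := by
    rw [Matrix.transpose_mul, Matrix.transpose_mul, hR.orth_left.compl.symm,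
      hR.orth_right.compl.symm, Matrix.mul_assoc, Matrix.trace_mul_comm, Matrix.mul_assoc,
      Matrix.mul_assoc, ← Matrix.mul_assoc (1 - R * M), hY0, Matrix.mul_zero, Matrix.trace_zero]
  rw [e, Matrix.transpose_add, Matrix.add_mul, Matrix.trace_add, h2, add_zero] at h1
  have := eq_zero_of_trace_transpose_mul_self h1
  exact (sub_eq_zero.mp this).symm

end tangentSpace

/-! ### The right-hand side and the increment function -/

section increments

variable {l m r : ℕ} {T K : ℝ} {L : ℝ → Matrix (Fin l) (Fin m) ℝ → Matrix (Fin l) (Fin m) ℝ}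
  {Lbar : ℝ → Matrix (Fin l) (Fin m) ℝ → ℝ → Matrix (Fin l) (Fin m) ℝ}

lemma continuousOn_uncurry_of_lipschitz (hLcont : ∀ A, ContinuousOn (fun t => L t A) (Icc 0 T))
    (hK : 0 ≤ K) (hL : ∀ t ∈ Icc 0 T, ∀ A B, ‖L t A - L t B‖ ≤ K * ‖A - B‖) :
    ContinuousOn (fun p : ℝ × Matrix (Fin l) (Fin m) ℝ => L p.1 p.2) (Icc 0 T ×ˢ univ) := by
  refine continuousOn_prod_of_continuousOn_lipschitzOnWith' _ ⟨K, hK⟩ (fun t ht => ?_)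
    (fun A _ => hLcont A)
  refine LipschitzOnWith.of_dist_le_mul fun A _ B _ => ?_
  rw [dist_eq_norm, dist_eq_norm]
  exact hL t ht A B

lemma exists_norm_le_of_norm_le (hLcont : ∀ A, ContinuousOn (fun t => L t A) (Icc 0 T))
    (hK : 0 ≤ K) (hL : ∀ t ∈ Icc 0 T, ∀ A B, ‖L t A - L t B‖ ≤ K * ‖A - B‖) (ρ : ℝ) :
    ∃ C, 0 ≤ C ∧ ∀ t ∈ Icc 0 T, ∀ A, ‖A‖ ≤ ρ → ‖L t A‖ ≤ C := by
  obtain ⟨C, hC⟩ := isCompact_Icc.exists_bound_of_continuousOn (hLcont 0)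
  refine ⟨|C| + K * |ρ|, by positivity, fun t ht A hA => ?_⟩
  have h1 := hL t ht A 0
  have h2 := hC t ht
  have h3 := norm_le_norm_add_norm_sub' (L t A) (L t 0)
  rw [sub_zero] at h1
  have : K * ‖A‖ ≤ K * |ρ| := by gcongr; exact hA.trans (le_abs_self ρ)
  linarith [le_abs_self C]

lemma exists_modulus (hLcont : ∀ A, ContinuousOn (fun t => L t A) (Icc 0 T))
    (hK : 0 ≤ K) (hL : ∀ t ∈ Icc 0 T, ∀ A B, ‖L t A - L t B‖ ≤ K * ‖A - B‖) (ρ : ℝ) {ε : ℝ}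
    (hε : 0 < ε) :
    ∃ δ > 0, ∀ s ∈ Icc 0 T, ∀ t ∈ Icc 0 T, |s - t| < δ → ∀ A, ‖A‖ ≤ ρ → ‖L s A - L t A‖ ≤ ε := by
  have hc : IsCompact (Icc 0 T ×ˢ Metric.closedBall (0 : Matrix (Fin l) (Fin m) ℝ) ρ) :=
    isCompact_Icc.prod (isCompact_closedBall _ _)
  have hu := hc.uniformContinuousOn_of_continuous
    ((continuousOn_uncurry_of_lipschitz hLcont hK hL).mono (prod_mono_right (subset_univ _)))
  obtain ⟨δ, hδ, h⟩ := Metric.uniformContinuousOn_iff.mp hu ε hε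
  refine ⟨δ, hδ, fun s hs t ht hst A hA => ?_⟩
  have hA' : A ∈ Metric.closedBall (0 : Matrix (Fin l) (Fin m) ℝ) ρ := by
    rwa [mem_closedBall_zero_iff]
  have := h (s, A) ⟨hs, hA'⟩ (t, A) ⟨ht, hA'⟩ (by
    rw [Prod.dist_eq, dist_self, max_eq_left dist_nonneg, Real.dist_eq]; exact hst)
  rw [dist_eq_norm] at this
  exact this.le

/-- `Lbar` is uniformly continuous on a compact set of arguments; the values at step `h` and step 0
are compared. -/
lemma IsConsistentIncrement.uniform (h : IsConsistentIncrement T L Lbar) (ρ : ℝ) {ε : ℝ}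
    (hε : 0 < ε) :
    ∃ h₁ > 0, ∀ t h A, 0 ≤ t → 0 < h → h ≤ h₁ → t + h ≤ T → ‖A‖ ≤ ρ →
      ‖Lbar t A h - L t A‖ ≤ ε := by
  obtain ⟨h₀, hh₀, hcont⟩ := h.continuousOn
  have hclosed : IsClosed {p : ℝ × Matrix (Fin l) (Fin m) ℝ × ℝ | p.1 + p.2.2 ≤ T} :=
    isClosed_le (by fun_prop) continuous_const
  have hc : IsCompact ((Icc 0 T ×ˢ Metric.closedBall (0 : Matrix (Fin l) (Fin m) ℝ) ρ ×ˢ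
      Icc 0 h₀) ∩ {p | p.1 + p.2.2 ≤ T}) :=
    (isCompact_Icc.prod ((isCompact_closedBall _ _).prod isCompact_Icc)).inter_right hclosed
  have hu := hc.uniformContinuousOn_of_continuous
    (hcont.mono fun p hp => ⟨hp.1.1.1, hp.1.2.2.1, hp.1.2.2.2, hp.2⟩)
  obtain ⟨δ, hδ, hd⟩ := Metric.uniformContinuousOn_iff.mp hu ε hε
  refine ⟨min h₀ (δ / 2), by positivity, fun t k A ht hk hk1 htk hA => ?_⟩
  have hA' : A ∈ Metric.closedBall (0 : Matrix (Fin l) (Fin m) ℝ) ρ := by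
    rwa [mem_closedBall_zero_iff]
  have htT : t ∈ Icc 0 T := ⟨ht, by linarith⟩
  have hkh : k ≤ h₀ := hk1.trans (min_le_left _ _)
  have hkδ : k ≤ δ / 2 := hk1.trans (min_le_right _ _)
  have := hd (t, A, k) ⟨⟨htT, hA', hk.le, hkh⟩, htk⟩ (t, A, 0)
    ⟨⟨htT, hA', le_refl 0, hh₀.le⟩, by simpa using htT.2⟩ (by
      simp only [Prod.dist_eq, dist_self, Real.dist_eq, sub_zero, abs_of_pos hk]
      simp only [max_lt_iff]
      exact ⟨hδ, hδ, by linarith⟩)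
  rw [dist_eq_norm] at this
  simp only [h.consistent t htT A] at this
  exact this.le

lemma norm_inv_smul_integral_sub_le {E : Type*} [NormedAddCommGroup E] [NormedSpace ℝ E]
    [CompleteSpace E] {f : ℝ → E} {c : E} {t k ε : ℝ} (hk : 0 < k)
    (hf : ContinuousOn f (Icc t (t + k))) (h : ∀ s ∈ Icc t (t + k), ‖f s - c‖ ≤ ε) :
    ‖(k⁻¹ • ∫ s in t..(t + k), f s) - c‖ ≤ ε := by
  have hint : IntervalIntegrable f volume t (t + k) :=
    hf.intervalIntegrable_of_Icc (by linarith)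
  have e : (k⁻¹ • ∫ s in t..(t + k), f s) - c = k⁻¹ • ∫ s in t..(t + k), (f s - c) := by
    rw [intervalIntegral.integral_sub hint intervalIntegrable_const,
      intervalIntegral.integral_const, smul_sub, add_sub_cancel_left, smul_smul,
      inv_mul_cancel₀ hk.ne', one_smul]
  have hI : ‖∫ s in t..(t + k), (f s - c)‖ ≤ ε * |t + k - t| :=
    intervalIntegral.norm_integral_le_of_norm_le_const fun s hs => by
      rw [uIoc_of_le (by linarith)] at hs
      exact h s ⟨hs.1.le, hs.2⟩
  rw [add_sub_cancel_left, abs_of_pos hk] at hI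
  rw [e, norm_smul, norm_inv, Real.norm_of_nonneg hk.le, inv_mul_le_iff₀ hk]
  linarith

/-- Gronwall keeps the exact trajectory close to `A` during a short step, so its velocity stays
close to `L t A`, and so does the mean velocity. -/
lemma IsExactIncrement.uniform (hLcont : ∀ A, ContinuousOn (fun t => L t A) (Icc 0 T))
    (hK : 0 ≤ K) (hL : ∀ t ∈ Icc 0 T, ∀ A B, ‖L t A - L t B‖ ≤ K * ‖A - B‖)
    (h : IsExactIncrement T L Lbar) (ρ : ℝ) {ε : ℝ} (hε : 0 < ε) :
    ∃ h₁ > 0, ∀ t h A, 0 ≤ t → 0 < h → h ≤ h₁ → t + h ≤ T → ‖A‖ ≤ ρ →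
      ‖Lbar t A h - L t A‖ ≤ ε := by
  obtain ⟨C, hC0, hC⟩ := exists_norm_le_of_norm_le hLcont hK hL ρ
  obtain ⟨δ, hδ, hmod⟩ := exists_modulus hLcont hK hL ρ (half_pos hε)
  have hg : ∀ᶠ x in 𝓝 (0 : ℝ), K * gronwallBound 0 K C x < ε / 2 := by
    have hc : ContinuousAt (fun x => K * gronwallBound 0 K C x) 0 :=
      (hasDerivAt_gronwallBound 0 K C 0).continuousAt.const_mul K
    refine hc.eventually_lt_const ?_
    simpa only [gronwallBound_x0, mul_zero] using half_pos hε
  obtain ⟨η, hη, hg⟩ := Metric.eventually_nhds_iff.mp hg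
  refine ⟨min (δ / 2) (η / 2), by positivity, fun t k A ht hk hk1 htk hA => ?_⟩
  have hkδ : k ≤ δ / 2 := hk1.trans (min_le_left _ _)
  have hkη : k ≤ η / 2 := hk1.trans (min_le_right _ _)
  have hgk := hg (y := k) (by rw [Real.dist_eq, sub_zero, abs_of_pos hk]; linarith)
  have hsub : Icc t (t + k) ⊆ Icc 0 T := Icc_subset_Icc ht htk
  have htT : t ∈ Icc 0 T := hsub ⟨le_rfl, by linarith⟩
  obtain ⟨y, hyt, hy, hLb⟩ := h t k A ht hk htk
  have hyc : ContinuousOn y (Icc t (t + k)) := fun s hs => (hy s hs).continuousWithinAt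
  have hgron : ∀ s ∈ Icc t (t + k), ‖y s - A‖ ≤ gronwallBound 0 K C (s - t) := by
    refine norm_le_gronwallBound_of_norm_deriv_right_le (f := fun s => y s - A)
      (f' := fun s => L s (y s)) (hyc.sub continuousOn_const) (fun s hs => ?_)
      (by simp [hyt]) (fun s hs => ?_)
    · exact ((hy s ⟨hs.1, hs.2.le⟩).mono_of_mem_nhdsWithin
        (Icc_mem_nhdsGE_of_mem hs)).sub_const A
    · have hs' := hsub ⟨hs.1, hs.2.le⟩
      have h1 := norm_le_norm_add_norm_sub' (L s (y s)) (L s A)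
      linarith [hL s hs' (y s) A, hC s hs' A hA]
  have hbound : ∀ s ∈ Icc t (t + k), ‖L s (y s) - L t A‖ ≤ ε := fun s hs => by
    have h1 := hL s (hsub hs) (y s) A
    have h2 := hmod s (hsub hs) t htT (by
      rw [abs_of_nonneg (sub_nonneg.mpr hs.1)]; linarith [hs.2]) A hA
    have h3 : K * ‖y s - A‖ ≤ K * gronwallBound 0 K C k := by
      gcongr
      exact (hgron s hs).trans (gronwallBound_mono le_rfl hC0 hK (by linarith [hs.2]))
    have h4 := norm_sub_le_norm_sub_add_norm_sub (L s (y s)) (L s A) (L t A)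
    linarith
  have hcont : ContinuousOn (fun s => L s (y s)) (Icc t (t + k)) :=
    (continuousOn_uncurry_of_lipschitz hLcont hK hL).comp (continuousOn_id.prodMk hyc)
      fun s hs => ⟨hsub hs, mem_univ _⟩
  rw [hLb]
  exact norm_inv_smul_integral_sub_le hk hcont hbound

end increments

/-! ### The dynamically orthogonal solution -/

section solution

variable {l m r : ℕ} {T K : ℝ} {L : ℝ → Matrix (Fin l) (Fin m) ℝ → Matrix (Fin l) (Fin m) ℝ}
  {A₀ : Matrix (Fin l) (Fin m) ℝ} {R : ℝ → Matrix (Fin l) (Fin m) ℝ}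
  {M : ℝ → Matrix (Fin m) (Fin l) ℝ}

lemma exists_bound_pinv {s : Set ℝ} (hs : IsCompact s) (hR : ContinuousOn R s)
    (hM : ∀ t ∈ s, IsPinv r (R t) (M t)) : ∃ κ, 0 ≤ κ ∧ ∀ t ∈ s, ‖M t‖ ≤ κ := by
  -- The repeated membership puts the goal in the form of a predicate on arbitrary sets, as
  -- compactness induction requires.
  suffices ∃ κ, ∀ t ∈ s, t ∈ s → ‖M t‖ ≤ κ by
    obtain ⟨κ, hκ⟩ := this
    exact ⟨|κ|, abs_nonneg _, fun t ht => (hκ t ht ht).trans (le_abs_self κ)⟩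
  refine hs.induction_on (p := fun u => ∃ κ, ∀ t ∈ u, t ∈ s → ‖M t‖ ≤ κ) ⟨0, by simp⟩
    (fun u v huv ⟨κ, hκ⟩ => ⟨κ, fun t ht => hκ t (huv ht)⟩) ?_ fun t ht => ?_
  · rintro u v ⟨a, ha⟩ ⟨b, hb⟩
    refine ⟨max a b, fun t ht hts => ?_⟩
    rcases ht with h | h
    · exact (ha t h hts).trans (le_max_left _ _)
    · exact (hb t h hts).trans (le_max_right _ _)
  · have h1 : Tendsto (fun x => ‖M t‖ * ‖R t - R x‖) (𝓝[s] t) (𝓝 0) := by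
      have h := ((tendsto_const_nhds (x := R t)).sub (hR t ht)).norm.const_mul ‖M t‖
      simpa using h
    have h2 := h1.eventually_le_const (show (0 : ℝ) < 1 / 6 by norm_num)
    refine ⟨{x | ‖M t‖ * ‖R t - R x‖ ≤ 1 / 6}, h2, 2 * ‖M t‖, fun x hx hxs => ?_⟩
    exact (hM t ht).norm_le_two_mul (hM x hxs) hx

/-- No continuity of `M` is needed: the Lipschitz estimate involves the inverse at the base point
`t` only. -/
lemma continuousOn_tangentProj {s : Set ℝ} {X : ℝ → Matrix (Fin l) (Fin m) ℝ}
    (hR : ContinuousOn R s) (hX : ContinuousOn X s) (hM : ∀ t ∈ s, IsPinv r (R t) (M t)) :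
    ContinuousOn (fun t => tangentProj (R t) (M t) (X t)) s := by
  intro t ht
  refine tendsto_iff_norm_sub_tendsto_zero.mpr ?_
  have h0 : Tendsto (fun x => 4 * ‖M t‖ * ‖R x - R t‖ * ‖X x‖ + 2 * ‖X x - X t‖) (𝓝[s] t)
      (𝓝 (4 * ‖M t‖ * ‖R t - R t‖ * ‖X t‖ + 2 * ‖X t - X t‖)) :=
    ((((hR t ht).sub_const (R t)).norm.const_mul _).mul (hX t ht).norm).add
      (((hX t ht).sub_const (X t)).norm.const_mul 2)
  simp only [sub_self, norm_zero, mul_zero, zero_mul, add_zero] at h0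
  refine tendsto_of_tendsto_of_tendsto_of_le_of_le' tendsto_const_nhds h0
    (Eventually.of_forall fun _ => norm_nonneg _) ?_
  filter_upwards [self_mem_nhdsWithin] with x hx
  have h1 := norm_tangentProj_sub_le (hM t ht) (hM x hx) (X x)
  have h2 := norm_tangentProj_le (hM t ht) (X x - X t)
  rw [tangentProj_sub] at h2
  have h3 := norm_sub_le_norm_sub_add_norm_sub (tangentProj (R x) (M x) (X x))
    (tangentProj (R t) (M t) (X x)) (tangentProj (R t) (M t) (X t))
  linarith

lemma IsDOSolution.continuousOn (h : IsDOSolution r T L A₀ R) : ContinuousOn R (Icc 0 T) :=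
  fun t ht => by
    obtain ⟨P, -, hP⟩ := h.deriv t ht
    exact hP.continuousWithinAt

/-- The velocity of `R` is continuous on a compact interval, so the first-order expansion is uniform
in `t`. -/
lemma IsDOSolution.exists_increment_bound (h : IsDOSolution r T L A₀ R)
    (hLcont : ContinuousOn (fun p : ℝ × Matrix (Fin l) (Fin m) ℝ => L p.1 p.2) (Icc 0 T ×ˢ univ))
    (hM : ∀ t ∈ Icc 0 T, IsPinv r (R t) (M t)) {ε : ℝ} (hε : 0 < ε) :
    ∃ h₁ > 0, ∀ t k, 0 ≤ t → 0 < k → k ≤ h₁ → t + k ≤ T →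
      ‖R (t + k) - R t - k • tangentProj (R t) (M t) (L t (R t))‖ ≤ ε * k := by
  set F : ℝ → Matrix (Fin l) (Fin m) ℝ := fun t => tangentProj (R t) (M t) (L t (R t)) with hF
  have hX : ContinuousOn (fun t => L t (R t)) (Icc 0 T) :=
    hLcont.comp (continuousOn_id.prodMk h.continuousOn) fun s hs => ⟨hs, mem_univ _⟩
  have hd : ∀ t ∈ Icc 0 T, HasDerivWithinAt R (F t) (Icc 0 T) t := fun t ht => by
    obtain ⟨P, hP, hP'⟩ := h.deriv t ht
    rwa [hP.eq_tangentProj (h.mem t ht) (hM t ht)] at hP'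
  have hu := isCompact_Icc.uniformContinuousOn_of_continuous
    (continuousOn_tangentProj h.continuousOn hX hM)
  obtain ⟨δ, hδ, hu⟩ := Metric.uniformContinuousOn_iff.mp hu ε hε
  refine ⟨δ / 2, half_pos hδ, fun t k ht hk hk1 htk => ?_⟩
  have hsub : Icc t (t + k) ⊆ Icc 0 T := Icc_subset_Icc ht htk
  have hmv := Convex.norm_image_sub_le_of_norm_hasDerivWithin_le
    (f := fun s => R s - s • F t) (f' := fun s => F s - F t) (C := ε) (s := Icc t (t + k))
    (x := t) (y := t + k)
    (fun s hs => by
      have h1 := (hasDerivWithinAt_id s (Icc t (t + k))).smul_const (F t)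
      rw [one_smul] at h1
      exact ((hd s (hsub hs)).mono hsub).sub h1)
    (fun s hs => by
      have := hu s (hsub hs) t (hsub ⟨le_rfl, by linarith⟩) (by
        rw [Real.dist_eq, abs_of_nonneg (sub_nonneg.mpr hs.1)]; linarith [hs.2])
      rw [dist_eq_norm] at this
      exact this.le)
    (convex_Icc _ _) ⟨le_rfl, by linarith⟩ ⟨by linarith, le_rfl⟩
  have e : R (t + k) - (t + k) • F t - (R t - t • F t) = R (t + k) - R t - k • F t := by
    rw [add_smul]; abel
  rw [e, add_sub_cancel_left, Real.norm_of_nonneg hk.le] at hmv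
  exact hmv

end solution

/-! ### Stability and convergence of the scheme -/

section scheme

variable {l m r : ℕ} {T K : ℝ} {L : ℝ → Matrix (Fin l) (Fin m) ℝ → Matrix (Fin l) (Fin m) ℝ}
  {Lbar : ℝ → Matrix (Fin l) (Fin m) ℝ → ℝ → Matrix (Fin l) (Fin m) ℝ}
  {A₀ : Matrix (Fin l) (Fin m) ℝ} {R : ℝ → Matrix (Fin l) (Fin m) ℝ}

lemma norm_tangentProj_sub_tangentProj_le {R S X Y Z : Matrix (Fin l) (Fin m) ℝ}
    {M N : Matrix (Fin m) (Fin l) ℝ} (hR : IsPinv r R M) (hS : IsPinv r S N) :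
    ‖tangentProj S N X - tangentProj R M Z‖ ≤
      2 * ‖X - Y‖ + 2 * ‖Y - Z‖ + 4 * ‖M‖ * ‖S - R‖ * ‖Z‖ := by
  have e : tangentProj S N X - tangentProj R M Z = tangentProj S N (X - Y) +
      tangentProj S N (Y - Z) + (tangentProj S N Z - tangentProj R M Z) := by
    rw [tangentProj_sub, tangentProj_sub]; abel
  rw [e]
  refine (norm_add₃_le ..).trans ?_
  linarith [norm_tangentProj_le hS (X - Y), norm_tangentProj_le hS (Y - Z),
    norm_tangentProj_sub_le hR hS Z]

/-- One step of the scheme: existence and propagation of the error. -/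
lemma exists_step_bound (hK : 0 ≤ K)
    (hLcont : ∀ A, ContinuousOn (fun t => L t A) (Icc 0 T))
    (hL : ∀ t ∈ Icc 0 T, ∀ A B, ‖L t A - L t B‖ ≤ K * ‖A - B‖)
    (hLbar : ∀ ρ ε : ℝ, 0 < ε → ∃ h₁ > 0, ∀ t h A, 0 ≤ t → 0 < h → h ≤ h₁ → t + h ≤ T → ‖A‖ ≤ ρ →
      ‖Lbar t A h - L t A‖ ≤ ε)
    (hR : IsDOSolution r T L A₀ R) :
    ∃ C ≥ 0, ∃ η > 0, ∀ ε > 0, ∃ h₁ > 0, ∀ t h S, 0 ≤ t → 0 < h → h ≤ h₁ → t + h ≤ T →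
      (∃ N, IsPinv r S N) → ‖S - R t‖ ≤ η →
      (∃ B, IsTruncatedSVD r (S + h • Lbar t S h) B) ∧
      ∀ B, IsTruncatedSVD r (S + h • Lbar t S h) B →
        (∃ N, IsPinv r B N) ∧ ‖B - R (t + h)‖ ≤ (1 + C * h) * ‖S - R t‖ + ε * h := by
  have hpinv : ∀ t, ∃ N, t ∈ Icc 0 T → IsPinv r (R t) N := fun t => by
    by_cases ht : t ∈ Icc 0 T
    · obtain ⟨N, hN⟩ := exists_isPinv_of_rank_eq (hR.mem t ht)
      exact ⟨N, fun _ => hN⟩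
    · exact ⟨0, fun h => absurd h ht⟩
  choose M hM using hpinv
  obtain ⟨κ, hκ0, hκ⟩ := exists_bound_pinv isCompact_Icc hR.continuousOn hM
  obtain ⟨ρ, hρ⟩ := isCompact_Icc.exists_bound_of_continuousOn hR.continuousOn
  obtain ⟨C₁, hC₁0, hC₁⟩ := exists_norm_le_of_norm_le hLcont hK hL (ρ + 1)
  -- In the growth rate, `2 * K` comes from the variation of `L` and `4 * κ * C₁` from that of the
  -- tangent space. The radius keeps `S` in the ball of radius `ρ + 1` and its inverse below `2 *
  -- κ`. The `+ 1` in the denominators, here and below, covers `κ = 0`.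
  refine ⟨2 * K + 4 * κ * C₁, by positivity, min 1 (1 / (6 * κ + 1)), by positivity,
    fun ε hε => ?_⟩
  obtain ⟨h₁, hh₁, hinc⟩ := hR.exists_increment_bound
    (continuousOn_uncurry_of_lipschitz hLcont hK hL) hM (show 0 < ε / 4 by positivity)
  obtain ⟨h₂, hh₂, hcons⟩ := hLbar (ρ + 1) (min 1 (ε / 4)) (by positivity)
  set C₂ := C₁ + 1 with hC₂
  -- The third bound on the step makes truncation possible, and the fourth makes the quadratic
  -- truncation error at most `ε / 4 * h`. The rest of `ε` goes to the expansion of `R` (`ε / 4`)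
  -- and to consistency (`ε / 2`).
  refine ⟨min (min h₁ h₂) (min (1 / (12 * κ * C₂ + 1)) (ε / (64 * κ * C₂ ^ 2 + 1))), by positivity,
    fun t h S ht hh hle hth hS hSR => ?_⟩
  have hle₁ : h ≤ h₁ := hle.trans ((min_le_left _ _).trans (min_le_left _ _))
  have hle₂ : h ≤ h₂ := hle.trans ((min_le_left _ _).trans (min_le_right _ _))
  have hle₃ : h * (12 * κ * C₂ + 1) ≤ 1 := (le_div_iff₀ (by positivity)).mp
    (hle.trans ((min_le_right _ _).trans (min_le_left _ _)))
  have hle₄ : h * (64 * κ * C₂ ^ 2 + 1) ≤ ε := (le_div_iff₀ (by positivity)).mp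
    (hle.trans ((min_le_right _ _).trans (min_le_right _ _)))
  have htT : t ∈ Icc 0 T := ⟨ht, by linarith⟩
  have hMt := hM t htT
  have hκt := hκ t htT
  obtain ⟨N, hN⟩ := hS
  have hSR1 : ‖S - R t‖ ≤ 1 := hSR.trans (min_le_left _ _)
  have hSR2 : ‖S - R t‖ * (6 * κ + 1) ≤ 1 :=
    (le_div_iff₀ (by positivity)).mp (hSR.trans (min_le_right _ _))
  have hSρ : ‖S‖ ≤ ρ + 1 := by
    have := norm_le_norm_add_norm_sub' S (R t)
    linarith [hρ t htT]
  have hcons' := hcons t h S ht hh hle₂ hth hSρ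
  have hX : ‖Lbar t S h‖ ≤ C₂ := by
    have := norm_le_norm_add_norm_sub' (Lbar t S h) (L t S)
    linarith [hC₁ t htT S hSρ, hcons'.trans (min_le_left _ _)]
  have hNκ : ‖N‖ ≤ 2 * κ := by
    have h1 : ‖M t‖ * ‖R t - S‖ ≤ 1 / 6 := by
      rw [norm_sub_rev]
      have : ‖M t‖ * ‖S - R t‖ ≤ κ * ‖S - R t‖ := by gcongr
      linarith [norm_nonneg (S - R t)]
    linarith [hMt.norm_le_two_mul hN h1]
  have hAS : S + h • Lbar t S h - S = h • Lbar t S h := add_sub_cancel_left _ _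
  have hASn : ‖h • Lbar t S h‖ ≤ h * C₂ := by
    rw [norm_smul, Real.norm_of_nonneg hh.le]
    gcongr
  refine ⟨exists_isTruncatedSVD hN ?_, fun B hB => ?_⟩
  · rw [hAS]
    have : ‖N‖ * ‖h • Lbar t S h‖ ≤ 2 * κ * (h * C₂) := by gcongr
    linarith
  obtain ⟨N', hN', hl, hr, hbest⟩ := hB.exists_isPinv
  refine ⟨⟨N', hN'⟩, ?_⟩
  have b1 := norm_sub_sub_tangentProj_le hN hN' hl hr (hbest hN)
  rw [hAS, tangentProj_smul] at b1
  have b1' : ‖B - S - h • tangentProj S N (Lbar t S h)‖ ≤ ε / 4 * h := by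
    refine b1.trans ?_
    calc 8 * ‖N‖ * ‖h • Lbar t S h‖ ^ 2 ≤ 8 * (2 * κ) * (h * C₂) ^ 2 := by gcongr
      _ = (h * (64 * κ * C₂ ^ 2)) / 4 * h := by ring
      _ ≤ ε / 4 * h := by gcongr; linarith
  have b2 := hinc t h ht hh hle₁ hth
  have b3 : ‖h • (tangentProj S N (Lbar t S h) - tangentProj (R t) (M t) (L t (R t)))‖ ≤
      h * (ε / 2 + (2 * K + 4 * κ * C₁) * ‖S - R t‖) := by
    rw [norm_smul, Real.norm_of_nonneg hh.le]
    gcongr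
    refine (norm_tangentProj_sub_tangentProj_le (Y := L t S) hMt hN).trans ?_
    have h1 := hcons'.trans (min_le_right _ _)
    have h2 := hL t htT S (R t)
    have h3 : 4 * ‖M t‖ * ‖S - R t‖ * ‖L t (R t)‖ ≤ 4 * κ * ‖S - R t‖ * C₁ := by
      gcongr
      exact hC₁ t htT (R t) (by linarith [hρ t htT])
    linarith
  have e : B - R (t + h) = (B - S - h • tangentProj S N (Lbar t S h)) + (S - R t) +
      h • (tangentProj S N (Lbar t S h) - tangentProj (R t) (M t) (L t (R t))) -
      (R (t + h) - R t - h • tangentProj (R t) (M t) (L t (R t))) := by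
    rw [smul_sub]; abel
  rw [e]
  refine (norm_sub_le _ _).trans ?_
  have := norm_add₃_le (a := B - S - h • tangentProj S N (Lbar t S h)) (b := S - R t)
    (c := h • (tangentProj S N (Lbar t S h) - tangentProj (R t) (M t) (L t (R t))))
  linarith

/-- The sequence `s` is required to truncate only where truncation is possible; that it always is
belongs to the conclusion. Thus the statement serves both for constructing the scheme and for
estimating a given one. -/
lemma eventually_scheme_bound (hT : 0 < T) (hR : IsDOSolution r T L A₀ R)
    {C η : ℝ} (hC : 0 ≤ C) (hη : 0 < η)
    (hstep : ∀ ε > 0, ∃ h₁ > 0, ∀ t h S, 0 ≤ t → 0 < h → h ≤ h₁ → t + h ≤ T →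
      (∃ N, IsPinv r S N) → ‖S - R t‖ ≤ η →
      (∃ B, IsTruncatedSVD r (S + h • Lbar t S h) B) ∧
      ∀ B, IsTruncatedSVD r (S + h • Lbar t S h) B →
        (∃ N, IsPinv r B N) ∧ ‖B - R (t + h)‖ ≤ (1 + C * h) * ‖S - R t‖ + ε * h)
    {ε₀ : ℝ} (hε₀ : 0 < ε₀) :
    ∀ᶠ N : ℕ in atTop, ∀ s : ℕ → Matrix (Fin l) (Fin m) ℝ, s 0 = R 0 →
      (∀ n < N, (∃ B, IsTruncatedSVD r (s n + (T / N) • Lbar (n * (T / N)) (s n) (T / N)) B) →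
        IsTruncatedSVD r (s n + (T / N) • Lbar (n * (T / N)) (s n) (T / N)) (s (n + 1))) →
      (∀ n < N,
        IsTruncatedSVD r (s n + (T / N) • Lbar (n * (T / N)) (s n) (T / N)) (s (n + 1))) ∧
      ∀ n ≤ N, ‖s n - R (n * (T / N))‖ ≤ ε₀ := by
  -- With this choice the accumulated error `T * ε * Real.exp (C * T)` is exactly `min η ε₀`, so the
  -- iterates never leave the tube of radius `η` where the step estimate applies.
  set ε := min η ε₀ / (T * Real.exp (C * T)) with hεdef
  have hε : 0 < ε := by positivity
  obtain ⟨h₁, hh₁, hstep⟩ := hstep ε hε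
  have hlim : Tendsto (fun N : ℕ => T / (N : ℝ)) atTop (𝓝 0) :=
    tendsto_const_div_atTop_nhds_zero_nat T
  filter_upwards [hlim.eventually_le_const hh₁, eventually_ge_atTop 1] with N hN1 hN s hs0 hs
  set h := T / (N : ℝ) with hh
  have hNpos : (0 : ℝ) < N := by exact_mod_cast hN
  have hpos : 0 < h := by positivity
  have hNh : (N : ℝ) * h = T := by rw [hh]; field_simp
  have htn : ∀ n ≤ N, (n : ℝ) * h ≤ T := fun n hn => by
    rw [← hNh]
    gcongr
  have hbd : ∀ n ≤ N, n * h * ε * Real.exp (C * (n * h)) ≤ min η ε₀ := fun n hn => by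
    have h1 := htn n hn
    calc n * h * ε * Real.exp (C * (n * h)) ≤ T * ε * Real.exp (C * T) := by gcongr
      _ = min η ε₀ := by rw [hεdef]; field_simp
  have main : ∀ n ≤ N, (∃ M, IsPinv r (s n) M) ∧
      ‖s n - R (n * h)‖ ≤ n * h * ε * Real.exp (C * (n * h)) := by
    intro n
    induction n with
    | zero =>
      intro _
      refine ⟨?_, by simp [hs0]⟩
      rw [hs0]
      exact exists_isPinv_of_rank_eq (hR.mem 0 ⟨le_rfl, hT.le⟩)
    | succ n ih =>
      intro hn
      obtain ⟨hp, hb⟩ := ih (by omega)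
      have hcast : ((n + 1 : ℕ) : ℝ) * h = n * h + h := by push_cast; ring
      have hn1 := htn (n + 1) hn
      rw [hcast] at hn1
      obtain ⟨hex, hall⟩ := hstep (n * h) h (s n) (by positivity) hpos hN1 hn1 hp
        ((hb.trans (hbd n (by omega))).trans (min_le_left _ _))
      obtain ⟨hp', hb'⟩ := hall _ (hs n (by omega) hex)
      refine ⟨hp', ?_⟩
      rw [hcast]
      refine hb'.trans ?_
      have e1 : 1 + C * h ≤ Real.exp (C * h) := by linarith [Real.add_one_le_exp (C * h)]
      have e2 : (1 : ℝ) ≤ Real.exp (C * (n * h + h)) := Real.one_le_exp (by positivity)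
      calc (1 + C * h) * ‖s n - R (n * h)‖ + ε * h
          ≤ Real.exp (C * h) * (n * h * ε * Real.exp (C * (n * h))) +
            ε * h * Real.exp (C * (n * h + h)) :=
              add_le_add (by gcongr) (le_mul_of_one_le_right (by positivity) e2)
        _ = (n * h + h) * ε * Real.exp (C * (n * h + h)) := by
              rw [show C * (n * h + h) = C * h + C * (n * h) by ring, Real.exp_add]
              ring
  refine ⟨fun n hn => hs n hn ?_, fun n hn =>
    ((main n hn).2.trans (hbd n hn)).trans (min_le_right _ _)⟩
  obtain ⟨hp, hb⟩ := main n hn.le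
  have hn1 := htn (n + 1) hn
  push_cast at hn1
  exact (hstep (n * h) h (s n) (by positivity) hpos hN1 (by linarith) hp
    ((hb.trans (hbd n hn.le)).trans (min_le_left _ _))).1

lemma IsTruncationScheme.unique {N : ℕ} {S S' : Fin (N + 1) → Matrix (Fin l) (Fin m) ℝ}
    (h : IsTruncationScheme r T Lbar A₀ N S) (h' : IsTruncationScheme r T Lbar A₀ N S') :
    S = S' := by
  funext n
  induction n using Fin.induction with
  | zero => exact h.initial.unique h'.initial
  | succ n ih =>
    have h1 := h.step n
    rw [ih] at h1
    exact h1.unique (h'.step n)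

end scheme

theorem mainTheorem5 (l m r : ℕ) (T : ℝ) (hT : 0 < T)
    (L : ℝ → Matrix (Fin l) (Fin m) ℝ → Matrix (Fin l) (Fin m) ℝ)
    (hLcont : ∀ A, ContinuousOn (fun t => L t A) (Icc 0 T))
    (hLlip : ∃ K : ℝ, ∀ t ∈ Icc 0 T, ∀ A B, ‖L t A - L t B‖ ≤ K * ‖A - B‖)
    (Lbar : ℝ → Matrix (Fin l) (Fin m) ℝ → ℝ → Matrix (Fin l) (Fin m) ℝ)
    (hLbar : IsExactIncrement T L Lbar ∨ IsConsistentIncrement T L Lbar)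
    (A₀ : Matrix (Fin l) (Fin m) ℝ) (R : ℝ → Matrix (Fin l) (Fin m) ℝ)
    (hR : IsDOSolution r T L A₀ R) :
    (∀ᶠ N : ℕ in atTop, ∃! S : Fin (N + 1) → Matrix (Fin l) (Fin m) ℝ,
      IsTruncationScheme r T Lbar A₀ N S) ∧
    ∀ S : (N : ℕ) → Fin (N + 1) → Matrix (Fin l) (Fin m) ℝ,
      (∀ᶠ N : ℕ in atTop, IsTruncationScheme r T Lbar A₀ N (S N)) →
      Tendsto (fun N : ℕ => ⨆ n : Fin (N + 1), ‖S N n - R (n * (T / N))‖) atTop (𝓝 0) := by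
  obtain ⟨K, hK, hL⟩ : ∃ K, 0 ≤ K ∧ ∀ t ∈ Icc 0 T, ∀ A B, ‖L t A - L t B‖ ≤ K * ‖A - B‖ := by
    obtain ⟨K, hL⟩ := hLlip
    exact ⟨|K|, abs_nonneg K, fun t ht A B => (hL t ht A B).trans (by gcongr; exact le_abs_self K)⟩
  have hunif : ∀ ρ ε : ℝ, 0 < ε → ∃ h₁ > 0, ∀ t h A, 0 ≤ t → 0 < h → h ≤ h₁ → t + h ≤ T →
      ‖A‖ ≤ ρ → ‖Lbar t A h - L t A‖ ≤ ε := fun ρ ε hε => by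
    rcases hLbar with h | h
    · exact h.uniform hLcont hK hL ρ hε
    · exact h.uniform ρ hε
  obtain ⟨C, hC, η, hη, hstep⟩ := exists_step_bound hK hLcont hL hunif hR
  have key := fun ε₀ (hε₀ : (0 : ℝ) < ε₀) => eventually_scheme_bound hT hR hC hη hstep hε₀
  constructor
  · filter_upwards [key 1 one_pos] with N hN
    classical
    let A : ℕ → Matrix (Fin l) (Fin m) ℝ → Matrix (Fin l) (Fin m) ℝ :=
      fun n X => X + (T / N) • Lbar (n * (T / N)) X (T / N)
    -- The default 0 is never taken before step `N`, as `hall` shows.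
    let s : ℕ → Matrix (Fin l) (Fin m) ℝ := fun n => Nat.rec (R 0)
      (fun n X => if h : ∃ B, IsTruncatedSVD r (A n X) B then h.choose else 0) n
    have hs : ∀ n < N, (∃ B, IsTruncatedSVD r (A n (s n)) B) →
        IsTruncatedSVD r (A n (s n)) (s (n + 1)) := fun n _ h => by
      have : s (n + 1) = h.choose := dif_pos h
      rw [this]
      exact h.choose_spec
    have hall := (hN s rfl hs).1
    have hscheme : IsTruncationScheme r T Lbar A₀ N (fun n : Fin (N + 1) => s n) :=
      ⟨hR.initial, fun n => hall n n.isLt⟩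
    exact ⟨_, hscheme, fun S' hS' => hS'.unique hscheme⟩
  · intro S hS
    rw [Metric.tendsto_nhds]
    intro ε hε
    filter_upwards [hS, key (ε / 2) (half_pos hε)] with N hSN hN
    let s : ℕ → Matrix (Fin l) (Fin m) ℝ := fun n => if h : n < N + 1 then S N ⟨n, h⟩ else 0
    have hsval : ∀ n (h : n < N + 1), s n = S N ⟨n, h⟩ := fun n h => dif_pos h
    have hb := (hN s (by
        rw [hsval 0 (by omega)]
        exact hSN.initial.unique hR.initial)
      (fun n hn _ => by
        rw [hsval n (by omega), hsval (n + 1) (by omega)]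
        exact hSN.step ⟨n, hn⟩)).2
    have hle : ⨆ n : Fin (N + 1), ‖S N n - R (n * (T / N))‖ ≤ ε / 2 := ciSup_le fun n => by
      have := hb n (by omega)
      rwa [hsval n n.isLt] at this
    rw [Real.dist_eq, sub_zero, abs_of_nonneg (Real.iSup_nonneg fun _ => norm_nonneg _)]
    linarith
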